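/- All bipartite graphs are finite, simple, with bipartition $L\cup R$; such a graph is $(d_1,d_2)$-biregular if every vertex of $L$ has degree $d_1$ and every vertex of $R$ has degree $d_2$; $N(S)$ is the set of neighbours of $S$. A family $(G_m)_{m\ge 0}$ of bipartite graphs $G_m=(L_m\cup R_m,E_m)$ is \emph{strongly explicit} if the sides can be numbered $0,\dots,|L_m|-1$ and $0,\dots,|R_m|-1$ so that some algorithm, given $m$, a side, the number of a vertex $v$ on this side and an index $i<\deg v$, outputs the number of the $i$-th neighbour of $v$ (for some ordering of the neighbours of $v$), and some algorithm, given $m$, outputs $|L_m|$ and $|R_m|$, both in time polynomial in $\log(|L_m|+|R_m|)$ (random access machine with logarithmic cost). \textbf{The graphs $CD(k,q,A,B)$.} Let $F$ be the field with $q$ elements, $k\ge 6$ odd, $r=\lfloor (k+2)/4\rfloor$, and $A,B\subseteq F\setminus\{0\}$. Vectors in $F^k$ are written $$u=(u_1,u_{1,1},u_{1,2},u_{2,1},u_{2,2},u'_{2,2},u_{2,3},u_{3,2},u_{3,3},u'_{3,3},\dots,u_{i,i},u'_{i,i},u_{i,i+1},u_{i+1,i},\dots)$$ (truncated to $k$ coordinates).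 They are regarded as points $p$ or as lines $l$, with the conventions $p_{0,-1}=l_{0,-1}=p_{1,0}=l_{0,1}=0$, $p_{0,0}=l_{0,0}=-1$, $p'_{0,0}=l'_{0,0}=1$, $p_{0,1}=p_1$, $l_{1,0}=l_1$, $p'_{1,1}=p_{1,1}$, $l'_{1,1}=l_{1,1}$. A point $p$ and a line $l$ are adjacent if for all $i\ge 1$ $$l_{i,i}-p_{i,i}=l_1p_{i-1,i},\quad l'_{i,i}-p'_{i,i}=p_1l_{i,i-1},\quad l_{i,i+1}-p_{i,i+1}=p_1l_{i,i},\quad l_{i+1,i}-p_{i+1,i}=l_1p'_{i,i},$$ where equations involving coordinates beyond the first $k$ are ignored. Then $CD(k,q,A,B)$ is the bipartite graph whose left vertices are the points $p$ with $p_1\in A$ and right vertices are the lines $l$ with $l_1\in B$, in both cases only those vectors $u$ with $$\sum_{i=0}^{t}\bigl(u_{i,i}\,u'_{t-i,t-i}-u_{i,i+1}\,u_{t-i,t-i-1}\bigr)=0\qquad(2\le t\le r).$$ \textbf{Theorem.} Let $0\le\beta_0<\beta_1\le 1$ and $\varepsilon_1,\varepsilon_2\in(0,1]$. There are infinitely many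 pairs $(d_1,d_2)$ of positive integers with $d_1\le d_2$ and $d_1/d_2\in[\beta_0,\beta_1]$ for which there exist $\delta=\delta(d_1,d_2,\varepsilon_1,\varepsilon_2)>0$, a prime power $q$, sets $A,B\subseteq F\setminus\{0\}$ (with $F$ the field with $q$ elements) with $|B|=d_1$ and $|A|=d_2$, and odd integers $k_m\ge 6$ $(m=0,1,2,\dots)$ such that the graphs $G_m=CD(k_m,q,A,B)=(L_m\cup R_m,E_m)$ form a strongly explicit family of $(d_1,d_2)$-biregular graphs, the number of vertices of $G_m$ is strictly increasing in $m$, and for every $m$: 1. every $S\subseteq L_m$ with $|S|\le\delta|L_m|^{1/3-\varepsilon_2}$ satisfies $|N(S)|\ge(1-\varepsilon_1)d_1|S|$; 2. every $S\subseteq R_m$ with $|S|\le\delta|R_m|^{1/3-\varepsilon_2}$ satisfies $|N(S)|\ge(1-\varepsilon_1)d_2|S|$. -/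

import Mathlib

/-! ## Finite bipartite graphs -/

/-- A finite simple bipartite graph with its bipartition `Left ∪ Right`. -/
structure BipartiteGraph where
  Left : Type
  Right : Type
  Adj : Left → Right → Prop
  [finiteLeft : Finite Left]
  [finiteRight : Finite Right]

namespace BipartiteGraph

attribute [instance] BipartiteGraph.finiteLeft BipartiteGraph.finiteRight

/-- The same graph with the two sides exchanged. -/
def swap (G : BipartiteGraph) : BipartiteGraph where
  Left := G.Right
  Right := G.Left
  Adj w v := G.Adj v w

/-- The number of vertices `|L| + |R|`. -/
noncomputable def order (G : BipartiteGraph) : ℕ := Nat.card G.Left + Nat.card G.Right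

/-- `N(S)` for a set `S` of left vertices. -/
def neighbors (G : BipartiteGraph) (S : Set G.Left) : Set G.Right :=
  {w | ∃ v ∈ S, G.Adj v w}

/-- The degree of a left vertex. -/
noncomputable def leftDegree (G : BipartiteGraph) (v : G.Left) : ℕ := {w | G.Adj v w}.ncard

/-- Left vertices have degree `d₁`, right vertices have degree `d₂`. -/
def IsBiregular (G : BipartiteGraph) (d₁ d₂ : ℕ) : Prop :=
  (∀ v : G.Left, G.leftDegree v = d₁) ∧ (∀ w : G.Right, G.swap.leftDegree w = d₂)

/-- Every left set `S` with `|S| ≤ s` has at least `c * |S|` neighbours. -/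
def LeftExpands (G : BipartiteGraph) (s c : ℝ) : Prop :=
  ∀ S : Set G.Left, (S.ncard : ℝ) ≤ s → c * (S.ncard : ℝ) ≤ ((G.neighbors S).ncard : ℝ)

end BipartiteGraph

/-! ## Random access machines with logarithmic cost -/

namespace Ram

/-- A store assigns a natural number to each address. -/
abbrev Store := ℕ → ℕ

/-- Structured programs of a random access machine. -/
inductive Prog : Type where
  /-- do nothing -/
  | skip : Prog
  /-- `M[a] := c` -/
  | const (a c : ℕ) : Prog
  /-- `M[a] := M[b] + M[c]` -/
  | add (a b c : ℕ) : Prog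
  /-- `M[a] := M[b] - M[c]`, truncated at `0` -/
  | sub (a b c : ℕ) : Prog
  /-- `M[a] := M[b] * M[c]` -/
  | mul (a b c : ℕ) : Prog
  /-- `M[a] := M[b] / M[c]`, rounded down -/
  | div (a b c : ℕ) : Prog
  /-- `M[a] := M[M[b]]` -/
  | load (a b : ℕ) : Prog
  /-- `M[M[a]] := M[b]` -/
  | store (a b : ℕ) : Prog
  /-- first `p`, then `q` -/
  | seq (p q : Prog) : Prog
  /-- if `M[a] ≠ 0` then `p` else `q` -/
  | ite (a : ℕ) (p q : Prog) : Prog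
  /-- while `M[a] ≠ 0` do `p` -/
  | loop (a : ℕ) (p : Prog) : Prog

/-- The number of binary digits of `n` (and `1` for `n = 0`). -/
def len (n : ℕ) : ℕ := Nat.log 2 n + 1

/-- The logarithmic cost of an arithmetic instruction `M[a] := M[b] ∘ M[c]`. -/
def arithCost (σ : Store) (a b c : ℕ) : ℕ := len a + len b + len c + len (σ b) + len (σ c)

/-- The cost of testing `M[a] ≠ 0`. -/
def testCost (σ : Store) (a : ℕ) : ℕ := len a + len (σ a)

/-- `Exec P σ τ t`: started in the store `σ`, the program `P` halts in the store `τ`, and the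
total logarithmic cost of the executed instructions and tests is `t`. -/
inductive Exec : Prog → Store → Store → ℕ → Prop where
  | skip (σ : Store) : Exec .skip σ σ 1
  | const (σ : Store) (a c : ℕ) :
      Exec (.const a c) σ (Function.update σ a c) (len a + len c)
  | add (σ : Store) (a b c : ℕ) :
      Exec (.add a b c) σ (Function.update σ a (σ b + σ c)) (arithCost σ a b c)
  | sub (σ : Store) (a b c : ℕ) :
      Exec (.sub a b c) σ (Function.update σ a (σ b - σ c)) (arithCost σ a b c)
  | mul (σ : Store) (a b c : ℕ) :
      Exec (.mul a b c) σ (Function.update σ a (σ b * σ c)) (arithCost σ a b c)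
  | div (σ : Store) (a b c : ℕ) :
      Exec (.div a b c) σ (Function.update σ a (σ b / σ c)) (arithCost σ a b c)
  | load (σ : Store) (a b : ℕ) :
      Exec (.load a b) σ (Function.update σ a (σ (σ b)))
        (len a + len b + len (σ b) + len (σ (σ b)))
  | store (σ : Store) (a b : ℕ) :
      Exec (.store a b) σ (Function.update σ (σ a) (σ b))
        (len a + len b + len (σ a) + len (σ b))
  | seq {p q : Prog} {σ τ ρ : Store} {s t : ℕ} :
      Exec p σ τ s → Exec q τ ρ t → Exec (.seq p q) σ ρ (s + t)
  | iteTrue {a : ℕ} {p q : Prog} {σ τ : Store} {t : ℕ} :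
      σ a ≠ 0 → Exec p σ τ t → Exec (.ite a p q) σ τ (testCost σ a + t)
  | iteFalse {a : ℕ} {p q : Prog} {σ τ : Store} {t : ℕ} :
      σ a = 0 → Exec q σ τ t → Exec (.ite a p q) σ τ (testCost σ a + t)
  | loopStop {a : ℕ} {p : Prog} {σ : Store} :
      σ a = 0 → Exec (.loop a p) σ σ (testCost σ a)
  | loopStep {a : ℕ} {p : Prog} {σ τ ρ : Store} {s t : ℕ} :
      σ a ≠ 0 → Exec p σ τ s → Exec (.loop a p) τ ρ t →
        Exec (.loop a p) σ ρ (testCost σ a + s + t)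

/-- Started with the given list of numbers in the cells `0, 1, 2, …` and zeros elsewhere, the
program halts within time `t` with `out` in cell `0`. -/
def Prog.ComputesIn (P : Prog) (input : List ℕ) (out t : ℕ) : Prop :=
  ∃ (τ : Store) (s : ℕ), Exec P (fun j => input.getD j 0) τ s ∧ s ≤ t ∧ τ 0 = out

end Ram

/-- `P` lists neighbourhoods of left vertices: for every `v` there is an ordering `e` of the
neighbours of `v` such that, on the input consisting of the prefix `pre`, the number of `v` and
`i < deg v`, the program outputs the number of the `i`-th neighbour, within time `t`. -/
def BipartiteGraph.ListsLeftNeighbors (G : BipartiteGraph) (P : Ram.Prog)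
    (numL : G.Left ≃ Fin (Nat.card G.Left)) (numR : G.Right ≃ Fin (Nat.card G.Right))
    (pre : List ℕ) (t : ℕ) : Prop :=
  ∀ v : G.Left, ∃ e : Fin (G.leftDegree v) ≃ {w : G.Right // G.Adj v w},
    ∀ i : Fin (G.leftDegree v),
      P.ComputesIn (pre ++ [(numL v : ℕ), (i : ℕ)]) (numR (e i).1 : ℕ) t

/-- The family `G 0, G 1, …` is strongly explicit: with the two sides of `G m` numbered
`0, …, |L| - 1` and `0, …, |R| - 1`, one program computes from `m`, a side (`0` left, `1` right),
the number of a vertex `v` and an index `i` the number of the `i`-th neighbour of `v`, and one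
program computes the sizes of the two sides (so that the whole graph can be written down in time
polynomial in its size), both in time polynomial in `log |V(G m)|`. -/
def StronglyExplicit (G : ℕ → BipartiteGraph) : Prop :=
  ∃ (nbr size : Ram.Prog) (T : Polynomial ℕ)
    (numL : ∀ m, (G m).Left ≃ Fin (Nat.card (G m).Left))
    (numR : ∀ m, (G m).Right ≃ Fin (Nat.card (G m).Right)),
    ∀ m : ℕ,
      (G m).ListsLeftNeighbors nbr (numL m) (numR m) [m, 0] (T.eval (Nat.log 2 (G m).order)) ∧
      (G m).swap.ListsLeftNeighbors nbr (numR m) (numL m) [m, 1]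
        (T.eval (Nat.log 2 (G m).order)) ∧
      size.ComputesIn [m, 0] (Nat.card (G m).Left) (T.eval (Nat.log 2 (G m).order)) ∧
      size.ComputesIn [m, 1] (Nat.card (G m).Right) (T.eval (Nat.log 2 (G m).order))

/-! ## The graphs `D(k, q)` and `CD(k, q, A, B)`

A vector `u = (u₁, u₁₁, u₁₂, u₂₁, u₂₂, u'₂₂, u₂₃, u₃₂, u₃₃, u'₃₃, u₃₄, u₄₃, …)` in `F ^ k` is a
function on `Fin k`; coordinates are counted from `0`. -/

namespace LU

variable {F : Type} [Field F] {k : ℕ}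

/-- The coordinate at position `n`, and `0` beyond the end. -/
def entry (u : Fin k → F) (n : ℕ) : F := if h : n < k then u ⟨n, h⟩ else 0

/-- The position of `u_{i,i}`, for `i ≥ 1`. -/
def diagPos (i : ℕ) : ℕ := if i = 1 then 1 else 4 * i - 4

/-- The position of `u'_{i,i}`, for `i ≥ 1`; here `u'_{1,1}` is `u_{1,1}`. -/
def diagPos' (i : ℕ) : ℕ := 4 * i - 3

/-- The position of `u_{i,i+1}`, for `i ≥ 1`. -/
def upPos (i : ℕ) : ℕ := 4 * i - 2

/-- The position of `u_{i+1,i}`, for `i ≥ 1`. -/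
def downPos (i : ℕ) : ℕ := 4 * i - 1

/-- `u_{i,i}`, with `u_{0,0} = -1`. -/
def diag (u : Fin k → F) (i : ℕ) : F := if i = 0 then -1 else entry u (diagPos i)

/-- `u'_{i,i}`, with `u'_{0,0} = 1` and `u'_{1,1} = u_{1,1}`. -/
def diag' (u : Fin k → F) (i : ℕ) : F := if i = 0 then 1 else entry u (diagPos' i)

/-- `p_{i,i+1}` for a point `p`, with `p_{0,1} = p₁`. -/
def pointUp (p : Fin k → F) (i : ℕ) : F := if i = 0 then entry p 0 else entry p (upPos i)

/-- `p_{i,i-1}` for a point `p`, with `p_{0,-1} = p_{1,0} = 0`. -/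
def pointDown (p : Fin k → F) (i : ℕ) : F := if i ≤ 1 then 0 else entry p (downPos (i - 1))

/-- `l_{i,i+1}` for a line `l`, with `l_{0,1} = 0`. -/
def lineUp (l : Fin k → F) (i : ℕ) : F := if i = 0 then 0 else entry l (upPos i)

/-- `l_{i,i-1}` for a line `l`, with `l_{0,-1} = 0` and `l_{1,0} = l₁`. -/
def lineDown (l : Fin k → F) (i : ℕ) : F :=
  if i = 0 then 0 else if i = 1 then entry l 0 else entry l (downPos (i - 1))

/-- The point `p` and the line `l` are adjacent in `D(k, q)`, where `q = |F|`. An equation is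
imposed when its variables exist among the `k` coordinates. -/
def Incident (p l : Fin k → F) : Prop :=
  ∀ i : ℕ, 1 ≤ i →
    (diagPos i < k → diag l i - diag p i = entry l 0 * pointUp p (i - 1)) ∧
    (diagPos' i < k → diag' l i - diag' p i = entry p 0 * lineDown l i) ∧
    (upPos i < k → lineUp l i - pointUp p i = entry p 0 * diag l i) ∧
    (downPos i < k → lineDown l (i + 1) - pointDown p (i + 1) = entry l 0 * diag' p i)

/-- The component invariants `b_2, …, b_r` of the point `p` vanish, `r = ⌊(k + 2) / 4⌋`. -/
def PointCertificateZero (p : Fin k → F) : Prop :=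
  ∀ t : ℕ, 2 ≤ t → t ≤ (k + 2) / 4 →
    ∑ i ∈ Finset.range (t + 1),
      (diag p i * diag' p (t - i) - pointUp p i * pointDown p (t - i)) = 0

/-- The component invariants `b_2, …, b_r` of the line `l` vanish, `r = ⌊(k + 2) / 4⌋`. -/
def LineCertificateZero (l : Fin k → F) : Prop :=
  ∀ t : ℕ, 2 ≤ t → t ≤ (k + 2) / 4 →
    ∑ i ∈ Finset.range (t + 1),
      (diag l i * diag' l (t - i) - lineUp l i * lineDown l (t - i)) = 0

/-- `CD(k, q, A, B)`: the subgraph of `D(k, q)` induced on the points `p` with zero certificate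
and `p₁ ∈ A` (left side) and the lines `l` with zero certificate and `l₁ ∈ B` (right side). -/
def CD [Finite F] (k : ℕ) (A B : Finset F) : BipartiteGraph where
  Left := {p : Fin k → F // PointCertificateZero p ∧ entry p 0 ∈ A}
  Right := {l : Fin k → F // LineCertificateZero l ∧ entry l 0 ∈ B}
  Adj p l := Incident p.1 l.1

end LU

/-! Matrices. Arrange the coordinates of a vertex `u` in a 2×2 matrix M_u of power series:
(u_{i,i}), (u_{i,i+1}) in the first row and (u_{i,i-1}), (u'_{i,i}) in the second (`genMat`). For k
+ 1 = 4r, a point p and a line l are adjacent exactly when M_p · lower(l₁) = M_l · upper(-p₁) modulo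
X^(r+1) (`incident_iff`), and the certificate vanishes exactly when det M_u = -1 modulo X^(r+1)
(`det_genMat_iff`). The elementary matrices have determinant 1, so a zero certificate passes to all
neighbours; since they are invertible, a vertex has exactly one neighbour with each prescribed first
coordinate. This gives biregularity.

Unique walks. Following a walk multiplies the matrix of its start by an alternating product of
elementary matrices, whose parameters are differences of consecutive first coordinates. They are
nonzero if the walk does not backtrack, and the outermost ones are nonzero because 0 is not a
colour. The degrees in a column of such a product grow with its length, and the Euclidean algorithm
recovers the parameters from the column. As long as the degrees are at most r, nothing is lost
modulo X^(r+1); as the matrix of the start can be cancelled, nonbacktracking walks of n double steps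
with n + 1 ≤ r are determined by their endpoints (`uniqueWalks_left`, `uniqueWalks_right`).

Expansion. If |N(S)| < (1-ε)d|S|, a nonempty subgraph on part of S has left degrees above εd and
right degrees at least 2 (`exists_dense_subgraph`). For D ≤ εd it carries at least D^n
nonbacktracking walks from one vertex, whose endpoints are distinct elements of S, so |S| ≥ D^n
(`leftExpands_of_uniqueWalks`). Three of the four series are free and the determinant gives the
fourth, so a side has d·p^(3r-1) ≤ p^(3r) vertices. For a large prime p = d₂ + 1 and d₁ = ⌊β₁d₂⌋ one
can take D ≥ p^(1-3ε), and D^(r-1) exceeds a constant times |L|^(1/3-ε) (`rpow_card_lt`).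

Explicitness. The number of a vertex lists its free coefficients in base p. A neighbour is computed
coefficient by coefficient in r rounds; the convolutions in the determinant equation are single
digits of products of large integers (Kronecker substitution), so each round is a loop-free program.
-/

/-! ### Nonbacktracking walks and expansion -/

namespace BipartiteGraph

/-- A walk of double steps from a left vertex, each through a right vertex to another left
vertex, such that consecutive edges of the walk are distinct. -/
def IsNonbacktracking (G : BipartiteGraph) : G.Left → List (G.Right × G.Left) → Prop
  | _, [] => True
  | v, (w, v') :: t =>
    G.Adj v w ∧ G.Adj v' w ∧ v' ≠ v ∧ (∀ x ∈ t.head?, x.1 ≠ w) ∧ IsNonbacktracking G v' t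

/-- The last vertex of a walk of double steps. -/
def endpoint (G : BipartiteGraph) : G.Left → List (G.Right × G.Left) → G.Left
  | v, [] => v
  | _, (_, v') :: t => endpoint G v' t

/-- Nonbacktracking walks of `n` double steps are determined by their endpoints. -/
def UniqueWalks (G : BipartiteGraph) (n : ℕ) : Prop :=
  ∀ (v : G.Left) (l l' : List (G.Right × G.Left)), l.length = n → l'.length = n →
    G.IsNonbacktracking v l → G.IsNonbacktracking v l' → G.endpoint v l = G.endpoint v l' → l = l'

-- Each double step has D choices of a right vertex, and each of them leads on to some other left
-- vertex because right degrees are at least two. The forbidden `w₀` stands for the right vertex of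
-- the preceding double step and makes the induction work.
open Classical in
theorem exists_walks (G : BipartiteGraph) {S : Finset G.Left} {T : Finset G.Right} {D : ℕ}
    (hS : ∀ v ∈ S, D + 1 ≤ (T.filter (G.Adj v)).card)
    (hT : ∀ w ∈ T, ∀ v, ∃ v' ∈ S, v' ≠ v ∧ G.Adj v' w) (n : ℕ) :
    ∀ v ∈ S, ∀ w₀ : G.Right, ∃ X : Finset (List (G.Right × G.Left)), D ^ n ≤ X.card ∧
      ∀ l ∈ X, l.length = n ∧ G.IsNonbacktracking v l ∧ G.endpoint v l ∈ S ∧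
        ∀ x ∈ l.head?, x.1 ≠ w₀ := by
  induction n with
  | zero =>
    intro v hv w₀
    refine ⟨{[]}, by simp, ?_⟩
    simp [IsNonbacktracking, endpoint, hv]
  | succ n ih =>
    intro v hv w₀
    -- Excluding `w₀` costs one of the D + 1 neighbours.
    set N := (T.filter (G.Adj v)).erase w₀ with hN
    have hNc : D ≤ N.card := by
      have := Finset.pred_card_le_card_erase (s := T.filter (G.Adj v)) (a := w₀)
      have := hS v hv
      rw [← hN] at *
      omega
    have hmem : ∀ w ∈ N, w ≠ w₀ ∧ w ∈ T ∧ G.Adj v w := by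
      intro w hw
      simpa [hN] using hw
    have hf : ∀ w : G.Right, ∃ v' : G.Left, w ∈ N → v' ∈ S ∧ v' ≠ v ∧ G.Adj v' w := by
      intro w
      by_cases hw : w ∈ N
      · obtain ⟨v', h⟩ := hT w (hmem w hw).2.1 v
        exact ⟨v', fun _ => h⟩
      · exact ⟨v, fun h => absurd h hw⟩
    choose f hf using hf
    have hX : ∀ w : G.Right, ∃ X : Finset (List (G.Right × G.Left)), w ∈ N → D ^ n ≤ X.card ∧
        ∀ l ∈ X, l.length = n ∧ G.IsNonbacktracking (f w) l ∧ G.endpoint (f w) l ∈ S ∧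
          ∀ x ∈ l.head?, x.1 ≠ w := by
      intro w
      by_cases hw : w ∈ N
      · obtain ⟨X, h⟩ := ih (f w) (hf w hw).1 w
        exact ⟨X, fun _ => h⟩
      · exact ⟨∅, fun h => absurd h hw⟩
    choose X hX using hX
    refine ⟨N.biUnion fun w => (X w).image (List.cons (w, f w)), ?_, ?_⟩
    · rw [Finset.card_biUnion]
      · calc D ^ (n + 1) = D * D ^ n := by ring
          _ ≤ N.card * D ^ n := Nat.mul_le_mul_right _ hNc
          _ = ∑ w ∈ N, D ^ n := by simp
          _ ≤ _ := by
            refine Finset.sum_le_sum fun w hw => ?_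
            rw [Finset.card_image_of_injective _ (List.cons_injective)]
            exact (hX w hw).1
      · intro w _ w' _ hne
        rw [Function.onFun, Finset.disjoint_left]
        intro l hl hl'
        obtain ⟨t, -, rfl⟩ := Finset.mem_image.1 hl
        obtain ⟨t', -, h⟩ := Finset.mem_image.1 hl'
        simp only [List.cons.injEq, Prod.mk.injEq] at h
        exact hne h.1.1.symm
    · intro l hl
      obtain ⟨w, hw, hl⟩ := Finset.mem_biUnion.1 hl
      obtain ⟨t, ht, rfl⟩ := Finset.mem_image.1 hl
      obtain ⟨h1, h2, h3, h4⟩ := (hX w hw).2 t ht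
      obtain ⟨g1, g2, g3⟩ := hf w hw
      refine ⟨by simp [h1], ⟨(hmem w hw).2.2, g3, g2, h4, h2⟩, h3, ?_⟩
      simpa using (hmem w hw).1

open Classical in
/-- A set of left vertices with few neighbours spans a subgraph with large left degrees and right
degrees at least two. -/
theorem exists_dense_subgraph (G : BipartiteGraph) {S : Finset G.Left} {T : Finset G.Right}
    {c : ℝ} (h : c * S.card + T.card < ∑ v ∈ S, ((T.filter (G.Adj v)).card : ℝ)) :
    ∃ S' ⊆ S, ∃ T' ⊆ T, S'.Nonempty ∧ (∀ v ∈ S', c < ((T'.filter (G.Adj v)).card : ℝ)) ∧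
      ∀ w ∈ T', 2 ≤ (S'.filter fun v => G.Adj v w).card := by
  -- Take a pair of minimal total size with this inequality: deleting a left vertex of degree at
  -- most `c`, or a right vertex of degree at most 1, would preserve it.
  have hex : ∃ n : ℕ, ∃ S' ⊆ S, ∃ T' ⊆ T, S'.card + T'.card = n ∧
      c * S'.card + T'.card < ∑ v ∈ S', ((T'.filter (G.Adj v)).card : ℝ) :=
    ⟨_, S, subset_rfl, T, subset_rfl, rfl, h⟩
  obtain ⟨S', hS', T', hT', hc, hlt⟩ := Nat.find_spec hex
  have hmin := fun m => Nat.find_min hex (m := m)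
  rw [← hc] at hmin
  refine ⟨S', hS', T', hT', ?_, ?_, ?_⟩
  · by_contra hne
    rw [Finset.not_nonempty_iff_eq_empty] at hne
    subst hne
    simp at hlt
    linarith [Nat.cast_nonneg (α := ℝ) T'.card]
  · intro v hv
    have hcard := Finset.card_erase_add_one hv
    have := hmin ((S'.erase v).card + T'.card) (by omega)
    by_contra hle
    refine this ⟨S'.erase v, (Finset.erase_subset _ _).trans hS', T', hT', rfl, ?_⟩
    rw [← Finset.add_sum_erase _ _ hv] at hlt
    have : (S'.card : ℝ) = (S'.erase v).card + 1 := by exact_mod_cast hcard.symm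
    rw [this] at hlt
    push Not at hle
    linarith
  · intro w hw
    have hcard := Finset.card_erase_add_one hw
    have := hmin (S'.card + (T'.erase w).card) (by omega)
    by_contra hle
    refine this ⟨S', hS', T'.erase w, (Finset.erase_subset _ _).trans hT', rfl, ?_⟩
    have hsum : ∑ v ∈ S', ((T'.filter (G.Adj v)).card : ℝ) =
        ∑ v ∈ S', (((T'.erase w).filter (G.Adj v)).card : ℝ) +
          ((S'.filter fun v => G.Adj v w).card : ℝ) := by
      rw [Finset.card_filter, Nat.cast_sum, ← Finset.sum_add_distrib]
      refine Finset.sum_congr rfl fun v _ => ?_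
      rw [Finset.filter_erase]
      by_cases hvw : G.Adj v w
      · rw [← Finset.card_erase_add_one (s := T'.filter (G.Adj v)) (a := w) (by simp [hw, hvw])]
        simp [hvw]
      · rw [Finset.erase_eq_of_notMem (by simp [hvw])]
        simp [hvw]
    have h1 : (T'.card : ℝ) = (T'.erase w).card + 1 := by exact_mod_cast hcard.symm
    have h2 : ((S'.filter fun v => G.Adj v w).card : ℝ) ≤ 1 := by
      exact_mod_cast (by omega : (S'.filter fun v => G.Adj v w).card ≤ 1)
    rw [hsum, h1] at hlt
    linarith

/-- Unique nonbacktracking walks force the expansion of small sets. -/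
theorem leftExpands_of_uniqueWalks {G : BipartiteGraph} {d n D : ℕ} {ε s : ℝ}
    (hdeg : ∀ v, G.leftDegree v = d) (hU : G.UniqueWalks n) (hD : (D : ℝ) ≤ ε * d)
    (hs : s < (D : ℝ) ^ n) : G.LeftExpands s ((1 - ε) * d) := by
  classical
  intro S hSs
  by_contra hlt
  push Not at hlt
  have : Fintype G.Left := Fintype.ofFinite _
  have : Fintype G.Right := Fintype.ofFinite _
  have hT : ∀ v ∈ S.toFinset, ((G.neighbors S).toFinset.filter (G.Adj v)).card = d := by
    intro v hv
    rw [← hdeg v, leftDegree, ← Set.ncard_coe_finset]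
    congr 1
    ext w
    have hv' : v ∈ S := by simpa using hv
    rw [Finset.mem_coe, Finset.mem_filter, Set.mem_toFinset]
    exact ⟨fun h => h.2, fun h => ⟨⟨v, hv', h⟩, h⟩⟩
  -- There are d|S| edges between S and N(S), so the failure of expansion is the required inequality
  -- with c = εd.
  obtain ⟨S', hS', T', -, ⟨v, hv⟩, h1, h2⟩ :=
    exists_dense_subgraph G (S := S.toFinset) (T := (G.neighbors S).toFinset) (c := ε * d) (by
      rw [Finset.sum_congr rfl fun v hv => by rw [hT v hv]]
      rw [← Set.ncard_eq_toFinset_card', ← Set.ncard_eq_toFinset_card', Finset.sum_const,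
        ← Set.ncard_eq_toFinset_card', nsmul_eq_mul]
      linarith)
  have h1' : ∀ v ∈ S', D + 1 ≤ (T'.filter (G.Adj v)).card := by
    intro v hv
    have := hD.trans_lt (h1 v hv)
    exact_mod_cast this
  have h2' : ∀ w ∈ T', ∀ v, ∃ v' ∈ S', v' ≠ v ∧ G.Adj v' w := by
    intro w hw v
    obtain ⟨v', hv', hne⟩ := Finset.exists_mem_ne (h2 w hw) v
    rw [Finset.mem_filter] at hv'
    exact ⟨v', hv'.1, hne, hv'.2⟩
  -- The first step is unconstrained; any right vertex serves as the forbidden one.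
  obtain ⟨w₀, -⟩ : (T'.filter (G.Adj v)).Nonempty := by
    rw [← Finset.card_pos]
    have := h1' v hv
    omega
  obtain ⟨X, hX, hX'⟩ := exists_walks G h1' h2' n v hv w₀
  have hle : X.card ≤ S'.card := by
    refine Finset.card_le_card_of_injOn (G.endpoint v) (fun l hl => (hX' l hl).2.2.1) ?_
    intro l hl l' hl' he
    obtain ⟨a1, a2, -⟩ := hX' l hl
    obtain ⟨b1, b2, -⟩ := hX' l' hl'
    exact hU v l l' a1 b1 a2 b2 he
  have hle' : (D : ℝ) ^ n ≤ S.ncard := by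
    rw [Set.ncard_eq_toFinset_card']
    exact_mod_cast hX.trans (hle.trans (Finset.card_le_card hS'))
  linarith

end BipartiteGraph

/-! ### Vertices as matrices of power series -/

namespace LU

open PowerSeries

section Matrices

variable {F : Type} [Field F] {k : ℕ}

/-- Power series over `F` modulo `X ^ (r + 1)`. -/
abbrev Trunc (F : Type) [Field F] (r : ℕ) : Type := F⟦X⟧ ⧸ Ideal.span {(X : F⟦X⟧) ^ (r + 1)}

/-- The reduction modulo `X ^ (r + 1)`. -/
noncomputable abbrev toTrunc (F : Type) [Field F] (r : ℕ) : F⟦X⟧ →+* Trunc F r := Ideal.Quotient.mk _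

theorem toTrunc_eq_iff {r : ℕ} {f g : F⟦X⟧} :
    toTrunc F r f = toTrunc F r g ↔ ∀ i ≤ r, coeff i f = coeff i g := by
  rw [Ideal.Quotient.eq, Ideal.mem_span_singleton, X_pow_dvd_iff]
  simp [sub_eq_zero]

/-- The sequence `u_{i,i+1}` with `u_{0,1} = x`. -/
def up (u : Fin k → F) (x : F) (i : ℕ) : F := if i = 0 then x else entry u (upPos i)

/-- The sequence `u_{i,i-1}` with `u_{0,-1} = 0` and `u_{1,0} = y`. -/
def down (u : Fin k → F) (y : F) (i : ℕ) : F :=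
  if i = 0 then 0 else if i = 1 then y else entry u (downPos (i - 1))

theorem pointUp_eq (p : Fin k → F) : pointUp p = up p (entry p 0) := rfl

theorem lineUp_eq (l : Fin k → F) : lineUp l = up l 0 := rfl

theorem lineDown_eq (l : Fin k → F) : lineDown l = down l (entry l 0) := rfl

theorem pointDown_eq (p : Fin k → F) : pointDown p = down p 0 := by
  funext i
  rcases i with - | - | i <;> simp [pointDown, down]

/-- The matrix of generating functions of a vector, with the conventional entries `u_{0,1} = x`
and `u_{1,0} = y`. -/
def genMat (u : Fin k → F) (x y : F) : Matrix (Fin 2) (Fin 2) F⟦X⟧ :=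
  !![mk (diag u), mk (up u x); mk (down u y), mk (diag' u)]

/-- The upper triangular elementary matrix. -/
noncomputable def upper (s : F) : Matrix (Fin 2) (Fin 2) F⟦X⟧ := !![1, C s; 0, 1]

/-- The lower triangular elementary matrix. -/
noncomputable def lower (s : F) : Matrix (Fin 2) (Fin 2) F⟦X⟧ := !![1, 0; C s * X, 1]

theorem upper_mul_upper (s t : F) : upper s * upper t = upper (s + t) := by
  simp [upper, add_comm]

theorem lower_mul_lower (s t : F) : lower s * lower t = lower (s + t) := by
  simp [lower, add_mul]

theorem upper_zero : upper (0 : F) = 1 := by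
  simp [upper, Matrix.one_fin_two]

theorem lower_zero : lower (0 : F) = 1 := by
  simp [lower, Matrix.one_fin_two]

theorem det_upper (s : F) : (upper s).det = 1 := by simp [upper, Matrix.det_fin_two]

theorem det_lower (s : F) : (lower s).det = 1 := by simp [lower, Matrix.det_fin_two]

/-- The entrywise reduction of matrices modulo `X ^ (r + 1)`. -/
noncomputable abbrev redMat (F : Type) [Field F] (r : ℕ) :
    Matrix (Fin 2) (Fin 2) F⟦X⟧ →+* Matrix (Fin 2) (Fin 2) (Trunc F r) :=
  (toTrunc F r).mapMatrix

theorem redMat_eq_iff {r : ℕ} {M N : Matrix (Fin 2) (Fin 2) F⟦X⟧} :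
    redMat F r M = redMat F r N ↔ ∀ a b, ∀ i ≤ r, coeff i (M a b) = coeff i (N a b) := by
  rw [← Matrix.ext_iff]
  simp only [RingHom.mapMatrix_apply, Matrix.map_apply, toTrunc_eq_iff]

theorem coeff_succ_mul_C_X (f : F⟦X⟧) (s : F) (i : ℕ) :
    coeff (i + 1) (f * (C s * X)) = coeff i f * s := by
  rw [← mul_assoc, coeff_succ_mul_X, coeff_mul_C]

/-- Incidence as a matrix equation. -/
theorem incident_iff {r : ℕ} (hk : k + 1 = 4 * r) (p l : Fin k → F) :
    Incident p l ↔ redMat F r (genMat p (entry p 0) 0 * lower (entry l 0)) =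
      redMat F r (genMat l 0 (entry l 0) * upper (-entry p 0)) := by
  -- The four entries are the four families of equations. For k + 1 = 4r an equation is imposed
  -- exactly when its index lies within the truncation; the coefficients fixed by convention agree
  -- automatically.
  rw [redMat_eq_iff]
  simp only [genMat, lower, upper, Matrix.mul_fin_two, Fin.forall_fin_two, Matrix.of_apply,
    Matrix.cons_val_zero, Matrix.cons_val_one, Matrix.cons_val', Matrix.cons_val_fin_one,
    mul_one, mul_zero, zero_add, add_zero, Incident, pointUp_eq, pointDown_eq, lineUp_eq,
    lineDown_eq]
  constructor
  · intro h
    refine ⟨⟨?_, ?_⟩, ?_, ?_⟩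
    · intro i hi
      rcases i with - | i
      · simp [diag]
      · have := (h (i + 1) (by omega)).1 (by unfold diagPos; split_ifs <;> omega)
        rw [map_add, coeff_succ_mul_C_X]
        simp only [coeff_mk, Nat.add_sub_cancel] at this ⊢
        linear_combination -this
    · intro i hi
      rcases i with - | i
      · simp [diag, up]
      · have := (h (i + 1) (by omega)).2.2.1 (by unfold upPos; omega)
        rw [map_add, coeff_mul_C]
        simp only [coeff_mk] at this ⊢
        linear_combination -this
    · intro i hi
      rcases i with - | - | i
      · simp [down]
      · rw [map_add, coeff_succ_mul_C_X]
        simp [down, diag']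
      · have := (h (i + 1) (by omega)).2.2.2 (by unfold downPos; omega)
        rw [map_add, coeff_succ_mul_C_X]
        simp only [coeff_mk] at this ⊢
        linear_combination -this
    · intro i hi
      rcases i with - | i
      · simp [diag', down]
      · have := (h (i + 1) (by omega)).2.1 (by unfold diagPos'; omega)
        rw [map_add, coeff_mul_C]
        simp only [coeff_mk] at this ⊢
        linear_combination -this
  · rintro ⟨⟨h1, h2⟩, h3, h4⟩ i hi
    obtain ⟨i, rfl⟩ : ∃ j, i = j + 1 := ⟨i - 1, by omega⟩
    refine ⟨fun h => ?_, fun h => ?_, fun h => ?_, fun h => ?_⟩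
    · have := h1 (i + 1) (by unfold diagPos at h; split_ifs at h <;> omega)
      rw [map_add, coeff_succ_mul_C_X] at this
      simp only [coeff_mk, Nat.add_sub_cancel] at this ⊢
      linear_combination -this
    · have := h4 (i + 1) (by unfold diagPos' at h; omega)
      rw [map_add, coeff_mul_C] at this
      simp only [coeff_mk] at this ⊢
      linear_combination -this
    · have := h2 (i + 1) (by unfold upPos at h; omega)
      rw [map_add, coeff_mul_C] at this
      simp only [coeff_mk] at this ⊢
      linear_combination -this
    · have := h3 (i + 1 + 1) (by unfold downPos at h; omega)
      rw [map_add, coeff_succ_mul_C_X] at this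
      simp only [coeff_mk] at this ⊢
      linear_combination -this

theorem diag_one_eq (u : Fin k → F) : diag u 1 = diag' u 1 := by
  simp [diag, diag', diagPos, diagPos']

/-- The conventions give the constant coefficient -1. The coefficient at X is -u'_{1,1} + u_{1,1} -
xy = 0, as u'_{1,1} and u_{1,1} are the same coordinate. So only t ≥ 2 carries a condition. -/
theorem det_genMat_iff {r : ℕ} (u : Fin k → F) {x y : F} (hxy : x * y = 0) :
    toTrunc F r (genMat u x y).det = -1 ↔ ∀ t : ℕ, 2 ≤ t → t ≤ r →
      ∑ i ∈ Finset.range (t + 1), (diag u i * diag' u (t - i) - up u x i * down u y (t - i)) = 0 := by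
  have hc : ∀ t, coeff t (genMat u x y).det =
      ∑ i ∈ Finset.range (t + 1), (diag u i * diag' u (t - i) - up u x i * down u y (t - i)) := by
    intro t
    rw [Matrix.det_fin_two, Finset.sum_sub_distrib, map_sub, coeff_mul, coeff_mul,
      Finset.Nat.sum_antidiagonal_eq_sum_range_succ_mk,
      Finset.Nat.sum_antidiagonal_eq_sum_range_succ_mk]
    simp [genMat]
  rw [show (-1 : Trunc F r) = toTrunc F r (-1) by simp, toTrunc_eq_iff]
  have h1 : ∀ t, coeff t (-1 : F⟦X⟧) = if t = 0 then -1 else 0 := by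
    intro t
    rw [map_neg, coeff_one]
    split_ifs <;> simp
  simp only [hc, h1]
  constructor
  · intro h t h2 ht
    rw [h t ht, if_neg (by omega)]
  · intro h t ht
    rcases t with - | - | t
    · simp [diag, diag', down]
    · simp [Finset.sum_range_succ, diag_one_eq]
      simp [diag, diag', down, up, hxy]
    · rw [h _ (by omega) ht, if_neg (by omega)]

theorem pointCertificateZero_iff {r : ℕ} (hk : k + 1 = 4 * r) (p : Fin k → F) :
    PointCertificateZero p ↔ toTrunc F r (genMat p (entry p 0) 0).det = -1 := by
  rw [det_genMat_iff _ (mul_zero _), PointCertificateZero, pointUp_eq, pointDown_eq,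
    show (k + 2) / 4 = r by omega]

theorem lineCertificateZero_iff {r : ℕ} (hk : k + 1 = 4 * r) (l : Fin k → F) :
    LineCertificateZero l ↔ toTrunc F r (genMat l 0 (entry l 0)).det = -1 := by
  rw [det_genMat_iff _ (zero_mul _), LineCertificateZero, lineUp_eq, lineDown_eq,
    show (k + 2) / 4 = r by omega]

theorem det_redMat (r : ℕ) (M : Matrix (Fin 2) (Fin 2) F⟦X⟧) :
    (redMat F r M).det = toTrunc F r M.det := by
  rw [RingHom.map_det]

/-- Cancellation of a matrix of determinant `-1`. -/
theorem mulVec_cancel_of_det {R n : Type*} [CommRing R] [Fintype n] [DecidableEq n]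
    {M : Matrix n n R} (hM : M.det = -1) {v w : n → R} (h : M.mulVec v = M.mulVec w) : v = w := by
  have := congrArg M.adjugate.mulVec h
  simpa [Matrix.adjugate_mul, hM, Matrix.neg_mulVec] using this

/-- A vector is determined by its first entry and its matrix. -/
theorem eq_of_redMat_genMat_eq {r : ℕ} (hk : k + 1 = 4 * r) {u v : Fin k → F} {x y : F}
    (h0 : entry u 0 = entry v 0)
    (h : redMat F r (genMat u x y) = redMat F r (genMat v x y)) : u = v := by
  rw [redMat_eq_iff] at h
  simp only [Fin.forall_fin_two, genMat, Matrix.of_apply, Matrix.cons_val_zero,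
    Matrix.cons_val_one, Matrix.cons_val', Matrix.cons_val_fin_one, coeff_mk] at h
  obtain ⟨⟨h1, h2⟩, h3, h4⟩ := h
  have key : ∀ n < k, entry u n = entry v n := by
    intro n hn
    -- The first coordinate is not an entry of the matrix for given x and y, whence the separate
    -- hypothesis `h0`.
    by_cases hn0 : n = 0
    · rw [hn0, h0]
    obtain ⟨q, hq | hq | hq | hq⟩ : ∃ q, n = 4 * q ∨ n = 4 * q + 1 ∨ n = 4 * q + 2 ∨
      n = 4 * q + 3 := ⟨n / 4, by omega⟩
    · have := h1 (q + 1) (by omega)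
      rw [diag, diag, if_neg (by omega), if_neg (by omega), diagPos, if_neg (by omega)] at this
      convert this using 2 <;> omega
    · have := h4 (q + 1) (by omega)
      rw [diag', diag', if_neg (by omega), if_neg (by omega), diagPos'] at this
      convert this using 2 <;> omega
    · have := h2 (q + 1) (by omega)
      rw [up, up, if_neg (by omega), if_neg (by omega), upPos] at this
      convert this using 2 <;> omega
    · have := h3 (q + 2) (by omega)
      rw [down, down, if_neg (by omega), if_neg (by omega), if_neg (by omega),
        if_neg (by omega), downPos] at this
      convert this using 2 <;> omega
  funext n
  have := key n n.2
  simpa [entry] using this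

/-- Every suitable matrix of power series comes from a vector. -/
theorem exists_genMat_eq {r : ℕ} (hk : k + 1 = 4 * r) {x y : F} (z : F) {a b c d : F⟦X⟧}
    (ha : coeff 0 a = -1) (hb : coeff 0 b = x) (hc0 : coeff 0 c = 0) (hc1 : coeff 1 c = y)
    (hd : coeff 0 d = 1) (had : coeff 1 a = coeff 1 d) :
    ∃ u : Fin k → F, entry u 0 = z ∧ redMat F r (genMat u x y) = redMat F r !![a, b; c, d] := by
  -- Positions modulo 4 separate the four series. The shared coordinate u_{1,1} at position 1 is
  -- taken from `d`, and `had` makes it right for `a`.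
  let e : ℕ → F := fun n => if n = 0 then z else if n % 4 = 0 then coeff (n / 4 + 1) a else
    if n % 4 = 1 then coeff (n / 4 + 1) d else if n % 4 = 2 then coeff (n / 4 + 1) b else
    coeff (n / 4 + 2) c
  have he : ∀ n < k, entry (fun j : Fin k => e j) n = e n := by
    intro n hn
    simp [entry, hn]
  refine ⟨fun j => e j, ?_, ?_⟩
  · rw [he 0 (by omega)]
    simp [e]
  · rw [redMat_eq_iff]
    simp only [Fin.forall_fin_two, genMat, Matrix.of_apply, Matrix.cons_val_zero,
      Matrix.cons_val_one, Matrix.cons_val', Matrix.cons_val_fin_one, coeff_mk]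
    have hdd : ∀ i ≤ r, diag' (fun j : Fin k => e j) i = coeff i d := by
      intro i hi
      rcases i with - | i
      · simp [diag', hd]
      · rw [diag', if_neg (by omega), diagPos', show 4 * (i + 1) - 3 = 4 * i + 1 by omega,
          he _ (by omega)]
        simp only [e]
        rw [if_neg (by omega), if_neg (by omega), if_pos (by omega)]
        congr 2
        omega
    refine ⟨⟨?_, ?_⟩, ?_, hdd⟩
    · intro i hi
      rcases i with - | - | i
      · simp [diag, ha]
      · rw [diag_one_eq, hdd 1 hi, had]
      · rw [diag, if_neg (by omega), diagPos, if_neg (by omega),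
          show 4 * (i + 2) - 4 = 4 * (i + 1) by omega, he _ (by omega)]
        simp only [e]
        rw [if_neg (by omega), if_pos (by omega)]
        congr 2
        omega
    · intro i hi
      rcases i with - | i
      · simp [up, hb]
      · rw [up, if_neg (by omega), upPos, show 4 * (i + 1) - 2 = 4 * i + 2 by omega,
          he _ (by omega)]
        simp only [e]
        rw [if_neg (by omega), if_neg (by omega), if_neg (by omega), if_pos (by omega)]
        congr 2
        omega
    · intro i hi
      rcases i with - | - | i
      · simp [down, hc0]
      · simp [down, hc1]
      · rw [down, if_neg (by omega), if_neg (by omega), downPos,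
          show 4 * (i + 2 - 1) - 1 = 4 * i + 3 by omega, he _ (by omega)]
        simp only [e]
        rw [if_neg (by omega), if_neg (by omega), if_neg (by omega), if_neg (by omega)]
        congr 2
        omega

/-- Inverting the upper factor expresses the matrix of the line by the point and l₁ alone, which
yields existence and uniqueness of the neighbour with a given first coordinate. -/
theorem incident_iff_line {r : ℕ} (hk : k + 1 = 4 * r) (p l : Fin k → F) :
    Incident p l ↔ redMat F r (genMat l 0 (entry l 0)) =
      redMat F r (genMat p (entry p 0) 0 * lower (entry l 0) * upper (entry p 0)) := by
  rw [incident_iff hk]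
  constructor
  · intro h
    rw [map_mul, h, ← map_mul, Matrix.mul_assoc, upper_mul_upper, neg_add_cancel, upper_zero,
      Matrix.mul_one]
  · intro h
    rw [map_mul _ _ (upper _), h, ← map_mul, Matrix.mul_assoc, upper_mul_upper, add_neg_cancel,
      upper_zero, Matrix.mul_one]

theorem incident_iff_point {r : ℕ} (hk : k + 1 = 4 * r) (p l : Fin k → F) :
    Incident p l ↔ redMat F r (genMat p (entry p 0) 0) =
      redMat F r (genMat l 0 (entry l 0) * upper (-entry p 0) * lower (-entry l 0)) := by
  rw [incident_iff hk]
  constructor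
  · intro h
    rw [map_mul, ← h, ← map_mul, Matrix.mul_assoc, lower_mul_lower, add_neg_cancel, lower_zero,
      Matrix.mul_one]
  · intro h
    rw [map_mul _ _ (lower _), h, ← map_mul, Matrix.mul_assoc, lower_mul_lower, neg_add_cancel,
      lower_zero, Matrix.mul_one]

/-- Elementary factors have determinant 1, so adjacent vertices have the same determinant. -/
theorem PointCertificateZero.line {r : ℕ} (hk : k + 1 = 4 * r) {p l : Fin k → F}
    (hp : PointCertificateZero p) (h : Incident p l) : LineCertificateZero l := by
  rw [pointCertificateZero_iff hk, ← det_redMat] at hp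
  rw [incident_iff_line hk] at h
  rw [lineCertificateZero_iff hk, ← det_redMat, h, map_mul, map_mul, Matrix.det_mul,
    Matrix.det_mul, hp, det_redMat, det_redMat, det_lower, det_upper]
  simp

theorem LineCertificateZero.point {r : ℕ} (hk : k + 1 = 4 * r) {p l : Fin k → F}
    (hl : LineCertificateZero l) (h : Incident p l) : PointCertificateZero p := by
  rw [lineCertificateZero_iff hk, ← det_redMat] at hl
  rw [incident_iff_point hk] at h
  rw [pointCertificateZero_iff hk, ← det_redMat, h, map_mul, map_mul, Matrix.det_mul,
    Matrix.det_mul, hl, det_redMat, det_redMat, det_lower, det_upper]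
  simp

/-- The product in `incident_iff_line` has the conventional low coefficients of a line, and the
coefficients at X of its two diagonal entries agree because both change by l₁p₁. So
`exists_genMat_eq` applies. -/
theorem exists_incident_line {r : ℕ} (hk : k + 1 = 4 * r) (p : Fin k → F) (y : F) :
    ∃ l : Fin k → F, entry l 0 = y ∧ Incident p l := by
  have hM : ∃ a b c d, genMat p (entry p 0) 0 * lower y * upper (entry p 0) = !![a, b; c, d] :=
    ⟨_, _, _, _, Matrix.eta_fin_two _⟩
  obtain ⟨a, b, c, d, hM⟩ := hM
  have hM' := hM
  simp only [genMat, lower, upper, Matrix.mul_fin_two, EmbeddingLike.apply_eq_iff_eq,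
    Matrix.vecCons_inj, mul_one, mul_zero, zero_add, add_zero, and_true] at hM'
  obtain ⟨⟨ha, hb⟩, hc, hd⟩ := hM'
  obtain ⟨l, hl, h⟩ := exists_genMat_eq (x := 0) (y := y) hk y (a := a) (b := b) (c := c) (d := d)
    (by simp [← ha, diag])
    (by simp [← hb, diag, up]) (by simp [← hc, down])
    (by rw [← hc, map_add, coeff_succ_mul_C_X]; simp [down, diag'])
    (by simp [← hd, diag', down])
    (by rw [← ha, ← hd, map_add, map_add, coeff_mul_C, map_add, coeff_succ_mul_C_X,
      coeff_succ_mul_C_X]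
        simp [down, diag', up, diag_one_eq]
        ring)
  refine ⟨l, hl, ?_⟩
  rw [incident_iff_line hk, hl, h, hM]

theorem exists_incident_point {r : ℕ} (hk : k + 1 = 4 * r) (l : Fin k → F) (x : F) :
    ∃ p : Fin k → F, entry p 0 = x ∧ Incident p l := by
  have hM : ∃ a b c d, genMat l 0 (entry l 0) * upper (-x) * lower (-entry l 0) =
    !![a, b; c, d] := ⟨_, _, _, _, Matrix.eta_fin_two _⟩
  obtain ⟨a, b, c, d, hM⟩ := hM
  have hM' := hM
  simp only [genMat, lower, upper, Matrix.mul_fin_two, EmbeddingLike.apply_eq_iff_eq,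
    Matrix.vecCons_inj, mul_one, mul_zero, zero_add, add_zero, and_true] at hM'
  obtain ⟨⟨ha, hb⟩, hc, hd⟩ := hM'
  obtain ⟨p, hp, h⟩ := exists_genMat_eq (x := x) (y := 0) hk x (a := a) (b := b) (c := c) (d := d)
    (by simp [← ha, diag])
    (by rw [← hb, map_add, coeff_mul_C]; simp [diag, up]) (by simp [← hc, down])
    (by rw [← hc, map_add, coeff_succ_mul_C_X, map_add, coeff_mul_C]; simp [down, diag'])
    (by rw [← hd, map_add, coeff_mul_C]; simp [diag', down])
    (by rw [← ha, ← hd, map_add, map_add, coeff_mul_C, coeff_succ_mul_C_X, map_add, coeff_mul_C]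
        simp [down, up, show diag l 0 = -1 by simp [diag], diag_one_eq]
        ring)
  refine ⟨p, hp, ?_⟩
  rw [incident_iff_point hk, hp, h, hM]

theorem Incident.line_unique {r : ℕ} (hk : k + 1 = 4 * r) {p l l' : Fin k → F}
    (h : Incident p l) (h' : Incident p l') (h0 : entry l 0 = entry l' 0) : l = l' := by
  rw [incident_iff_line hk] at h h'
  refine eq_of_redMat_genMat_eq (x := 0) (y := entry l 0) hk h0 ?_
  rw [h, h0, h']

theorem Incident.point_unique {r : ℕ} (hk : k + 1 = 4 * r) {p p' l : Fin k → F}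
    (h : Incident p l) (h' : Incident p' l) (h0 : entry p 0 = entry p' 0) : p = p' := by
  rw [incident_iff_point hk] at h h'
  refine eq_of_redMat_genMat_eq (x := entry p 0) (y := 0) hk h0 ?_
  rw [h, h0, h']

end Matrices

/-! ### Biregularity -/

section Neighbours

variable {F : Type} [Field F] [Finite F] {r k : ℕ}

/-- The neighbours of a point correspond to the possible first entries. -/
noncomputable def lineNeighbors (hk : k + 1 = 4 * r) (A B : Finset F) (p : (CD k A B).Left) :
    {l : (CD k A B).Right // (CD k A B).Adj p l} ≃ B :=
  Equiv.ofBijective (fun l => ⟨entry l.1.1 0, l.1.2.2⟩) (by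
    constructor
    · rintro ⟨l, hl⟩ ⟨l', hl'⟩ h
      exact Subtype.ext (Subtype.ext (Incident.line_unique hk hl hl' (by simpa using h)))
    · rintro ⟨y, hy⟩
      obtain ⟨l, hl, h⟩ := exists_incident_line hk p.1 y
      exact ⟨⟨⟨l, p.2.1.line hk h, hl ▸ hy⟩, h⟩, Subtype.ext hl⟩)

/-- The neighbours of a line correspond to the possible first entries. -/
noncomputable def pointNeighbors (hk : k + 1 = 4 * r) (A B : Finset F) (l : (CD k A B).Right) :
    {p : (CD k A B).Left // (CD k A B).Adj p l} ≃ A :=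
  Equiv.ofBijective (fun p => ⟨entry p.1.1 0, p.1.2.2⟩) (by
    constructor
    · rintro ⟨p, hp⟩ ⟨p', hp'⟩ h
      exact Subtype.ext (Subtype.ext (Incident.point_unique hk hp hp' (by simpa using h)))
    · rintro ⟨x, hx⟩
      obtain ⟨p, hp, h⟩ := exists_incident_point hk l.1 x
      exact ⟨⟨⟨p, l.2.1.point hk h, hp ▸ hx⟩, h⟩, Subtype.ext hp⟩)

theorem isBiregular_CD (hk : k + 1 = 4 * r) (A B : Finset F) : (CD k A B).IsBiregular B.card A.card := by
  refine ⟨fun p => ?_, fun l => ?_⟩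
  · exact (Nat.card_congr (lineNeighbors hk A B p)).trans (by simp)
  · exact (Nat.card_congr (pointNeighbors hk A B l)).trans (by simp)

end Neighbours

end LU

/-! ## Alternating words of elementary matrices -/

section Words

open Polynomial

variable {F : Type} [Field F]

/-- A sequence of pairs of colours in which consecutive first and second components differ. -/
def IsReducedWord : F → F → List (F × F) → Prop
  | y, _, [] => y ≠ 0
  | y, x, (y', x') :: t => y' ≠ y ∧ x' ≠ x ∧ IsReducedWord y' x' t

/-- The first column of the alternating word which starts with a lower triangular matrix. -/
noncomputable def lowerWord : F → F → List (F × F) → F[X] × F[X]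
  | y, _, [] => (1, C (-y) * X)
  | y, x, (y', x') :: t =>
    ((lowerWord y' x' t).1 + C (x - x') * (lowerWord y' x' t).2,
      (lowerWord y' x' t).2 + C (y' - y) * (X * ((lowerWord y' x' t).1 +
        C (x - x') * (lowerWord y' x' t).2)))

/-- The second column of the alternating word which starts with an upper triangular matrix. -/
noncomputable def upperWord : F → F → List (F × F) → F[X] × F[X]
  | x, _, [] => (C x, 1)
  | x, y, (x', y') :: t =>
    ((upperWord x' y' t).1 + C (x - x') * ((upperWord x' y' t).2 +
        C (y' - y) * (X * (upperWord x' y' t).1)),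
      (upperWord x' y' t).2 + C (y' - y) * (X * (upperWord x' y' t).1))

theorem degree_add_C_mul {f g : F[X]} {c : F} (hc : c ≠ 0) (h : f.degree < g.degree) :
    (f + C c * g).degree = g.degree := by
  rw [degree_add_eq_right_of_degree_lt] <;> rw [degree_C_mul hc]
  exact h

/-- Uniqueness of quotient and remainder in the division by `g`, for constant quotients. -/
theorem add_C_mul_inj {f f' g : F[X]} {c c' : F} (hf : f.degree < g.degree)
    (hf' : f'.degree < g.degree) (h : f + C c * g = f' + C c' * g) : c = c' ∧ f = f' := by
  have hcc : c = c' := by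
    by_contra hne
    have h1 : C (c - c') * g = f' - f := by
      rw [C_sub]
      linear_combination h
    have h2 := degree_sub_le f' f
    rw [← h1, degree_C_mul (sub_ne_zero.2 hne)] at h2
    exact absurd (h2.trans_lt (max_lt hf' hf)) (lt_irrefl _)
  subst hcc
  exact ⟨rfl, add_right_cancel h⟩

theorem degree_X_mul' (f : F[X]) : (X * f).degree = f.degree + 1 := by
  rw [degree_mul, degree_X, add_comm]

/-- A nonzero parameter makes the newly added term dominate, so the two degrees overtake each other
in turn. -/
theorem degree_lowerWord {y x : F} {l : List (F × F)} (h : IsReducedWord y x l) :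
    (lowerWord y x l).1.degree = (l.length : WithBot ℕ) ∧
      (lowerWord y x l).2.degree = ((l.length + 1 : ℕ) : WithBot ℕ) := by
  induction l generalizing y x with
  | nil =>
    have hy : -y ≠ 0 := neg_ne_zero.2 h
    simp only [lowerWord, degree_C_mul hy]
    simp
  | cons z t ih =>
    obtain ⟨y', x'⟩ := z
    obtain ⟨h1, h2, h3⟩ := h
    obtain ⟨i1, i2⟩ := ih h3
    have j1 : ((lowerWord y' x' t).1 + C (x - x') * (lowerWord y' x' t).2).degree =
        ((t.length + 1 : ℕ) : WithBot ℕ) := by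
      rw [degree_add_C_mul (sub_ne_zero.2 h2.symm), i2]
      rw [i1, i2]
      exact_mod_cast Nat.lt_succ_self _
    refine ⟨j1, ?_⟩
    rw [lowerWord, degree_add_C_mul (sub_ne_zero.2 h1), degree_X_mul', j1]
    · simp
    · rw [i2, degree_X_mul', j1]
      exact_mod_cast Nat.lt_succ_self _

theorem degree_upperWord {x y : F} {l : List (F × F)} (h : IsReducedWord x y l) :
    (upperWord x y l).1.degree = (l.length : WithBot ℕ) ∧
      (upperWord x y l).2.degree = (l.length : WithBot ℕ) := by
  induction l generalizing y x with
  | nil =>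
    have hx : x ≠ 0 := h
    simp [upperWord, degree_C hx]
  | cons z t ih =>
    obtain ⟨x', y'⟩ := z
    obtain ⟨h1, h2, h3⟩ := h
    obtain ⟨i1, i2⟩ := ih h3
    have j1 : ((upperWord x' y' t).2 + C (y' - y) * (X * (upperWord x' y' t).1)).degree =
        ((t.length + 1 : ℕ) : WithBot ℕ) := by
      rw [degree_add_C_mul (sub_ne_zero.2 h2), degree_X_mul', i1]
      · simp
      · rw [i2, degree_X_mul', i1]
        exact_mod_cast Nat.lt_succ_self _
    refine ⟨?_, j1⟩
    rw [upperWord, degree_add_C_mul (sub_ne_zero.2 h1.symm), j1]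
    · simp
    · rw [i1, j1]
      exact_mod_cast Nat.lt_succ_self _

/-- The word is a Euclidean algorithm run backwards: by the degrees, y' - y and then x - x' are
determined as quotients, and the remainders form the column of the shorter word. -/
theorem lowerWord_injective {y x : F} {l l' : List (F × F)} (hlen : l.length = l'.length)
    (h : IsReducedWord y x l) (h' : IsReducedWord y x l') (he : lowerWord y x l = lowerWord y x l') :
    l = l' := by
  induction l generalizing y x l' with
  | nil => exact (List.length_eq_zero_iff.1 hlen.symm).symm
  | cons z t ih =>
    obtain - | ⟨z', t'⟩ := l'
    · simp at hlen
    have hlen' : t.length = t'.length := by simpa using hlen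
    have d0 := degree_lowerWord h
    obtain ⟨y₁, x₁⟩ := z
    obtain ⟨y₂, x₂⟩ := z'
    obtain ⟨-, -, h3⟩ := h
    obtain ⟨-, -, h3'⟩ := h'
    have d1 := degree_lowerWord h3
    have d2 := degree_lowerWord h3'
    obtain ⟨e1, e2⟩ := Prod.ext_iff.1 he
    simp only [lowerWord] at d0 e1 e2
    rw [← e1] at e2
    obtain ⟨f1, f2⟩ := add_C_mul_inj (by
      rw [degree_X_mul', d0.1, d1.2]
      exact_mod_cast (by simp)) (by
      rw [degree_X_mul', d0.1, d2.2, ← hlen']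
      exact_mod_cast (by simp)) e2
    rw [← f2] at e1
    obtain ⟨g1, g2⟩ := add_C_mul_inj (by
      rw [d1.1, d1.2]
      exact_mod_cast (by simp)) (by
      rw [d2.1, d1.2, ← hlen']
      exact_mod_cast (by simp)) e1
    obtain rfl : y₁ = y₂ := by linear_combination f1
    obtain rfl : x₁ = x₂ := by linear_combination -g1
    rw [ih hlen' h3 h3' (Prod.ext g2 f2)]

theorem upperWord_injective {x y : F} {l l' : List (F × F)} (hlen : l.length = l'.length)
    (h : IsReducedWord x y l) (h' : IsReducedWord x y l') (he : upperWord x y l = upperWord x y l') :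
    l = l' := by
  induction l generalizing y x l' with
  | nil => exact (List.length_eq_zero_iff.1 hlen.symm).symm
  | cons z t ih =>
    obtain - | ⟨z', t'⟩ := l'
    · simp at hlen
    have hlen' : t.length = t'.length := by simpa using hlen
    have d0 := degree_upperWord h
    obtain ⟨y₁, x₁⟩ := z
    obtain ⟨y₂, x₂⟩ := z'
    obtain ⟨-, -, h3⟩ := h
    obtain ⟨-, -, h3'⟩ := h'
    have d1 := degree_upperWord h3
    have d2 := degree_upperWord h3'
    obtain ⟨e1, e2⟩ := Prod.ext_iff.1 he
    simp only [upperWord] at d0 e1 e2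
    rw [← e2] at e1
    obtain ⟨f1, f2⟩ := add_C_mul_inj (by
      rw [d0.2, d1.1]
      exact_mod_cast (by simp)) (by
      rw [d0.2, d2.1, ← hlen']
      exact_mod_cast (by simp)) e1
    rw [← f2] at e2
    obtain ⟨g1, g2⟩ := add_C_mul_inj (by
      rw [degree_X_mul', d1.1, d1.2]
      exact_mod_cast (by simp)) (by
      rw [degree_X_mul', d1.1, d2.2, ← hlen']
      exact_mod_cast (by simp)) e2
    obtain rfl : x₁ = x₂ := by linear_combination g1
    obtain rfl : y₁ = y₂ := by linear_combination -f1
    rw [ih hlen' h3 h3' (Prod.ext f2 g2)]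

end Words

/-! ## Uniqueness of nonbacktracking walks -/

namespace BipartiteGraph

variable {G : BipartiteGraph} {F : Type} [Field F]

/-- Colours are injective on each neighbourhood, so distinct consecutive vertices have distinct
colours. Here `y` is the colour of the preceding right vertex; `hμ0` supplies the condition on the
last parameter. -/
theorem isReducedWord_of_isNonbacktracking {κ : G.Left → F} {μ : G.Right → F}
    (hκ : ∀ v v' w, G.Adj v w → G.Adj v' w → κ v = κ v' → v = v')
    (hμ : ∀ v w w', G.Adj v w → G.Adj v w' → μ w = μ w' → w = w') (hμ0 : ∀ w, μ w ≠ 0)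
    {l : List (G.Right × G.Left)} {v : G.Left} {y : F} (hl : G.IsNonbacktracking v l)
    (hy : l = [] → y ≠ 0) (hy' : ∀ z ∈ l.head?, μ z.1 ≠ y) :
    IsReducedWord y (κ v) (l.map fun z => (μ z.1, κ z.2)) := by
  induction l generalizing v y with
  | nil => exact hy rfl
  | cons z t ih =>
    obtain ⟨w, v'⟩ := z
    obtain ⟨h1, h2, h3, h4, h5⟩ := hl
    refine ⟨by simpa using hy', fun h => h3 (hκ _ _ _ h2 h1 h), ih h5 (fun _ => hμ0 w) ?_⟩
    intro z hz he
    obtain - | ⟨⟨w', v''⟩, t⟩ := t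
    · simp at hz
    · simp only [List.head?_cons, Option.mem_def, Option.some.injEq] at hz
      subst hz
      exact h4 _ (by simp) (hμ _ _ _ h5.1 h2 he)

theorem eq_of_map_eq {K : Type*} {κ : G.Left → K} {μ : G.Right → K}
    (hκ : ∀ v v' w, G.Adj v w → G.Adj v' w → κ v = κ v' → v = v')
    (hμ : ∀ v w w', G.Adj v w → G.Adj v w' → μ w = μ w' → w = w')
    {l l' : List (G.Right × G.Left)} {v : G.Left} (hl : G.IsNonbacktracking v l)
    (hl' : G.IsNonbacktracking v l')
    (h : (l.map fun z => (μ z.1, κ z.2)) = l'.map fun z => (μ z.1, κ z.2)) : l = l' := by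
  induction l generalizing v l' with
  | nil => exact (List.map_eq_nil_iff.1 h.symm).symm
  | cons z t ih =>
    obtain - | ⟨z', t'⟩ := l'
    · simp at h
    obtain ⟨w, v₁⟩ := z
    obtain ⟨w', v₂⟩ := z'
    simp only [List.map_cons, List.cons.injEq, Prod.mk.injEq] at h
    obtain ⟨h1, h2, -, -, h5⟩ := hl
    obtain ⟨h1', h2', -, -, h5'⟩ := hl'
    obtain rfl := hμ _ _ _ h1 h1' h.1.1
    obtain rfl := hκ _ _ _ h2 h2' h.1.2
    rw [ih h5 h5' h.2]

/-- If walks between two given vertices have the same colours, then walks are unique. -/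
theorem uniqueWalks_of_coloring (κ : G.Left → F) (μ : G.Right → F)
    (hκ : ∀ v v' w, G.Adj v w → G.Adj v' w → κ v = κ v' → v = v')
    (hμ : ∀ v w w', G.Adj v w → G.Adj v w' → μ w = μ w' → w = w') (hμ0 : ∀ w, μ w ≠ 0) {n : ℕ}
    (h : ∀ v (l l' : List (G.Right × G.Left)), l.length = n → l'.length = n →
      G.IsNonbacktracking v l → G.IsNonbacktracking v l' →
      IsReducedWord 0 (κ v) (l.map fun z => (μ z.1, κ z.2)) →
      IsReducedWord 0 (κ v) (l'.map fun z => (μ z.1, κ z.2)) → G.endpoint v l = G.endpoint v l' →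
      (l.map fun z => (μ z.1, κ z.2)) = l'.map fun z => (μ z.1, κ z.2)) : G.UniqueWalks n := by
  intro v l l' hl hl' hv hv' he
  -- The empty word with y = 0 is not reduced, so n = 0 is treated apart.
  rcases Nat.eq_zero_or_pos n with rfl | hn
  · rw [List.length_eq_zero_iff.1 hl, List.length_eq_zero_iff.1 hl']
  · have key : ∀ l : List (G.Right × G.Left), l.length = n → G.IsNonbacktracking v l →
        IsReducedWord 0 (κ v) (l.map fun z => (μ z.1, κ z.2)) := by
      intro l hl hv
      refine isReducedWord_of_isNonbacktracking hκ hμ hμ0 hv ?_ (fun z _ => hμ0 _)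
      rintro rfl
      simp at hl
      omega
    exact eq_of_map_eq hκ hμ hv hv' (h v l l' hl hl' hv hv' (key l hl hv) (key l' hl' hv') he)

end BipartiteGraph

/-! ### Walks as products of elementary matrices -/

namespace LU

open PowerSeries

variable {F : Type} [Field F] {r k : ℕ}

/-- A pair of polynomials as a column vector of truncated power series. -/
noncomputable def column (F : Type) [Field F] (r : ℕ) (w : Polynomial F × Polynomial F) :
    Fin 2 → Trunc F r :=
  ![toTrunc F r w.1, toTrunc F r w.2]

/-- Polynomials of degree at most r survive the truncation modulo X^(r+1). -/
theorem column_injective {w w' : Polynomial F × Polynomial F} (h1 : w.1.degree ≤ r)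
    (h2 : w.2.degree ≤ r) (h1' : w'.1.degree ≤ r) (h2' : w'.2.degree ≤ r)
    (h : column F r w = column F r w') : w = w' := by
  have key : ∀ f g : Polynomial F, f.degree ≤ r → g.degree ≤ r →
      toTrunc F r (f : F⟦X⟧) = toTrunc F r (g : F⟦X⟧) → f = g := by
    intro f g hf hg he
    rw [toTrunc_eq_iff] at he
    ext i
    by_cases hi : i ≤ r
    · simpa using he i hi
    · have hr : (r : WithBot ℕ) < i := by exact_mod_cast not_le.1 hi
      rw [Polynomial.coeff_eq_zero_of_degree_lt (hf.trans_lt hr),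
        Polynomial.coeff_eq_zero_of_degree_lt (hg.trans_lt hr)]
  exact Prod.ext (key _ _ h1 h1' (congrFun h 0)) (key _ _ h2 h2' (congrFun h 1))

theorem column_upper (r : ℕ) (s : F) (w : Polynomial F × Polynomial F) :
    (redMat F r (upper s)).mulVec (column F r w) =
      column F r (w.1 + Polynomial.C s * w.2, w.2) := by
  funext i
  fin_cases i <;> simp [upper, column, Matrix.mulVec, dotProduct]

theorem column_lower (r : ℕ) (s : F) (w : Polynomial F × Polynomial F) :
    (redMat F r (lower s)).mulVec (column F r w) =
      column F r (w.1, w.2 + Polynomial.C s * (Polynomial.X * w.1)) := by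
  funext i
  fin_cases i <;> simp [lower, column, Matrix.mulVec, dotProduct, add_comm, mul_assoc]

theorem column_lowerWord_cons (r : ℕ) (y x y' x' : F) (t : List (F × F)) :
    column F r (lowerWord y x ((y', x') :: t)) =
      (redMat F r (lower (y' - y) * upper (x - x'))).mulVec (column F r (lowerWord y' x' t)) := by
  rw [map_mul, ← Matrix.mulVec_mulVec, column_upper, column_lower, lowerWord]

theorem column_upperWord_cons (r : ℕ) (x y x' y' : F) (t : List (F × F)) :
    column F r (upperWord x y ((x', y') :: t)) =
      (redMat F r (upper (x - x') * lower (y' - y))).mulVec (column F r (upperWord x' y' t)) := by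
  rw [map_mul, ← Matrix.mulVec_mulVec, column_lower, column_upper, upperWord]

variable [Finite F] {A B : Finset F}

/-- The product telescopes: for a double step p, w, p' with colours x, y', x', M_p · lower(y) ·
lower(y' - y) · upper(x - x') = M_w · upper(-x') = M_{p'} · lower(y'). The free `y` carries the
induction, and the last factor lower(-y) of the word cancels it. -/
theorem genMat_endpoint_left (hk : k + 1 = 4 * r) {l : List ((CD k A B).Right × (CD k A B).Left)}
    {p : (CD k A B).Left} (hl : (CD k A B).IsNonbacktracking p l) (y : F) :
    (redMat F r (genMat p.1 (entry p.1 0) 0 * lower y)).mulVec (column F r (lowerWord y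
        (entry p.1 0) (l.map fun z => (entry z.1.1 0, entry z.2.1 0)))) =
      (redMat F r (genMat ((CD k A B).endpoint p l).1 (entry ((CD k A B).endpoint p l).1 0)
        0)).mulVec (column F r (1, 0)) := by
  induction l generalizing p y with
  | nil =>
    rw [BipartiteGraph.endpoint, List.map_nil, map_mul, ← Matrix.mulVec_mulVec, lowerWord,
      column_lower]
    simp
  | cons z t ih =>
    obtain ⟨w, p'⟩ := z
    obtain ⟨h1, h2, -, -, h5⟩ := hl
    have h1 := (incident_iff hk _ _).1 h1
    have h2 := (incident_iff hk _ _).1 h2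
    rw [BipartiteGraph.endpoint, ← ih h5 (entry w.1 0), List.map_cons, column_lowerWord_cons,
      Matrix.mulVec_mulVec, ← map_mul]
    rw [Matrix.mul_assoc, ← Matrix.mul_assoc (lower y), lower_mul_lower, add_sub_cancel,
      ← Matrix.mul_assoc, map_mul, h1, h2, ← map_mul, Matrix.mul_assoc, upper_mul_upper,
      show -entry p.1 0 + (entry p.1 0 - entry p'.1 0) = -entry p'.1 0 by ring]

theorem genMat_endpoint_right (hk : k + 1 = 4 * r)
    {l : List ((CD k A B).Left × (CD k A B).Right)}
    {q : (CD k A B).Right} (hl : (CD k A B).swap.IsNonbacktracking q l) (x : F) :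
    (redMat F r (genMat q.1 0 (entry q.1 0) * upper (-x))).mulVec (column F r (upperWord x
        (entry q.1 0) (l.map fun z => (entry z.1.1 0, entry z.2.1 0)))) =
      (redMat F r (genMat ((CD k A B).swap.endpoint q l).1 0
        (entry ((CD k A B).swap.endpoint q l).1 0))).mulVec (column F r (0, 1)) := by
  induction l generalizing q x with
  | nil =>
    change _ = (redMat F r (genMat q.1 0 (entry q.1 0))).mulVec _
    rw [List.map_nil, map_mul, ← Matrix.mulVec_mulVec, upperWord,
      column_upper]
    simp
  | cons z t ih =>
    obtain ⟨p, q'⟩ := z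
    obtain ⟨h1, h2, -, -, h5⟩ := hl
    have h1 := (incident_iff hk _ _).1 h1
    have h2 := (incident_iff hk _ _).1 h2
    refine Eq.trans ?_ (ih h5 (entry p.1 0))
    rw [List.map_cons, column_upperWord_cons, Matrix.mulVec_mulVec, ← map_mul]
    rw [Matrix.mul_assoc, ← Matrix.mul_assoc (upper (-x)), upper_mul_upper,
      show -x + (x - entry p.1 0) = -entry p.1 0 by ring,
      ← Matrix.mul_assoc, map_mul, ← h1, ← h2, ← map_mul, Matrix.mul_assoc, lower_mul_lower]
    simp

/-- In `CD(k, q, A, B)` short nonbacktracking walks from a point are unique. -/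
theorem uniqueWalks_left (hk : k + 1 = 4 * r) (hB : (0 : F) ∉ B) {n : ℕ} (hn : n + 1 ≤ r) :
    (CD k A B).UniqueWalks n := by
  refine BipartiteGraph.uniqueWalks_of_coloring (fun p : (CD k A B).Left => entry p.1 0)
    (fun q : (CD k A B).Right => entry q.1 0)
    (fun v v' w h h' e => Subtype.ext (Incident.point_unique hk h h' e))
    (fun v w w' h h' e => Subtype.ext (Incident.line_unique hk h h' e))
    (fun w h => hB (h ▸ w.2.2)) ?_
  intro p l l' hl hl' hv hv' hw hw' he
  refine lowerWord_injective (by simp [hl, hl']) hw hw' ?_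
  have d := degree_lowerWord hw
  have d' := degree_lowerWord hw'
  rw [List.length_map, hl] at d
  rw [List.length_map, hl'] at d'
  have e1 := genMat_endpoint_left hk hv 0
  have e2 := genMat_endpoint_left hk hv' 0
  have e3 := e1.trans ((he ▸ rfl : _ = _).trans e2.symm)
  rw [lower_zero, Matrix.mul_one] at e3
  refine column_injective (r := r) ?_ ?_ ?_ ?_
    (mulVec_cancel_of_det (by rw [det_redMat]; exact (pointCertificateZero_iff hk _).1 p.2.1) e3)
  · rw [d.1]; exact_mod_cast (by omega)
  -- The second component has degree n + 1, which uses n + 1 ≤ r in full.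
  · rw [d.2]; exact_mod_cast (by omega)
  · rw [d'.1]; exact_mod_cast (by omega)
  · rw [d'.2]; exact_mod_cast (by omega)

/-- In `CD(k, q, A, B)` short nonbacktracking walks from a line are unique. -/
theorem uniqueWalks_right (hk : k + 1 = 4 * r) (hA : (0 : F) ∉ A) {n : ℕ} (hn : n + 1 ≤ r) :
    (CD k A B).swap.UniqueWalks n := by
  refine BipartiteGraph.uniqueWalks_of_coloring (fun p : (CD k A B).Right => entry p.1 0)
    (fun q : (CD k A B).Left => entry q.1 0)
    (fun v v' w h h' e => Subtype.ext (Incident.line_unique hk h h' e))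
    (fun v w w' h h' e => Subtype.ext (Incident.point_unique hk h h' e))
    (fun (w : (CD k A B).Left) (h : entry w.1 0 = 0) => hA (h ▸ w.2.2)) ?_
  intro p l l' hl hl' hv hv' hw hw' he
  refine upperWord_injective (by simp [hl, hl']) hw hw' ?_
  have d := degree_upperWord hw
  have d' := degree_upperWord hw'
  rw [List.length_map, hl] at d
  rw [List.length_map, hl'] at d'
  have e1 := genMat_endpoint_right hk hv 0
  have e2 := genMat_endpoint_right hk hv' 0
  have e3 := e1.trans ((he ▸ rfl : _ = _).trans e2.symm)
  rw [neg_zero, upper_zero, Matrix.mul_one] at e3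
  refine column_injective (r := r) ?_ ?_ ?_ ?_
    (mulVec_cancel_of_det (by rw [det_redMat]; exact (lineCertificateZero_iff hk _).1 p.2.1) e3)
  · rw [d.1]; exact_mod_cast (by omega)
  · rw [d.2]; exact_mod_cast (by omega)
  · rw [d'.1]; exact_mod_cast (by omega)
  · rw [d'.2]; exact_mod_cast (by omega)

end LU

/-! ## Numbering the vertices -/

namespace LU

section Digits

/-- The number with base `p` digits `a i, b i, c i, a (i+1), b (i+1), c (i+1), …` in `n` blocks. -/
def code (p : ℕ) (a b c : ℕ → ℕ) : ℕ → ℕ → ℕ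
  | 0, _ => 0
  | n + 1, i => a i + p * (b i + p * (c i + p * code p a b c n (i + 1)))

/-- Delete the digit of weight `p ^ 2`. -/
def squeeze (p n : ℕ) : ℕ := n % p ^ 2 + p ^ 2 * (n / p ^ 3)

/-- Insert the digit `c` with weight `p ^ 2`. -/
def unsqueeze (p c n : ℕ) : ℕ := n % p ^ 2 + p ^ 2 * (c + p * (n / p ^ 2))

variable {p : ℕ}

theorem code_lt {a b c : ℕ → ℕ} (ha : ∀ i, a i < p) (hb : ∀ i, b i < p)
    (hc : ∀ i, c i < p) (n i : ℕ) : code p a b c n i < p ^ (3 * n) := by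
  have key : ∀ x y m, x < p → y < m → x + p * y < p * m := by
    intro x y m hx hy
    calc x + p * y < p + p * y := by omega
      _ = p * (y + 1) := by ring
      _ ≤ p * m := Nat.mul_le_mul_left _ hy
  induction n generalizing i with
  | zero => simp [code]
  | succ n ih =>
    rw [show p ^ (3 * (n + 1)) = p * (p * (p * p ^ (3 * n))) by ring]
    exact key _ _ _ (ha i) (key _ _ _ (hb i) (key _ _ _ (hc i) (ih _)))

theorem add_mul_inj {x y x' y' : ℕ} (hx : x < p) (hx' : x' < p) (h : x + p * y = x' + p * y') :
    x = x' ∧ y = y' := by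
  have hp : 0 < p := by omega
  have h1 := congrArg (· % p) h
  have h2 := congrArg (· / p) h
  simpa [Nat.mod_eq_of_lt, hx, hx', Nat.add_mul_div_left, hp, Nat.div_eq_of_lt] using And.intro h1 h2

theorem code_inj {a b c a' b' c' : ℕ → ℕ} (ha : ∀ i, a i < p) (hb : ∀ i, b i < p)
    (hc : ∀ i, c i < p) (ha' : ∀ i, a' i < p) (hb' : ∀ i, b' i < p) (hc' : ∀ i, c' i < p)
    {n i : ℕ} (h : code p a b c n i = code p a' b' c' n i) :
    ∀ j < n, a (i + j) = a' (i + j) ∧ b (i + j) = b' (i + j) ∧ c (i + j) = c' (i + j) := by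
  induction n generalizing i with
  | zero => simp
  | succ n ih =>
    obtain ⟨h1, h⟩ := add_mul_inj (ha i) (ha' i) h
    obtain ⟨h2, h⟩ := add_mul_inj (hb i) (hb' i) h
    obtain ⟨h3, h⟩ := add_mul_inj (hc i) (hc' i) h
    intro j hj
    rcases j with - | j
    · exact ⟨h1, h2, h3⟩
    · have := ih h j (by omega)
      rwa [show i + 1 + j = i + (j + 1) by ring] at this

theorem code_eq {N n i : ℕ} {a b c : ℕ → ℕ} (hN : N < p ^ (3 * n))
    (h : ∀ j < n, a (i + j) = N / p ^ (3 * j) % p ∧ b (i + j) = N / p ^ (3 * j) / p % p ∧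
      c (i + j) = N / p ^ (3 * j) / p / p % p) : code p a b c n i = N := by
  induction n generalizing N i with
  | zero =>
    simp at hN
    simp [code, hN]
  | succ n ih =>
    have h0 := h 0 (by omega)
    simp only [add_zero, mul_zero, pow_zero, Nat.div_one] at h0
    rw [code, h0.1, h0.2.1, h0.2.2, ih (N := N / p / p / p)]
    · rw [Nat.mod_add_div, Nat.mod_add_div, Nat.mod_add_div]
    · rw [Nat.div_div_eq_div_mul, Nat.div_div_eq_div_mul]
      refine Nat.div_lt_of_lt_mul (hN.trans_eq (by ring))
    · intro j hj
      have := h (j + 1) (by omega)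
      rw [show i + (j + 1) = i + 1 + j by ring,
        show p ^ (3 * (j + 1)) = p * p * p * p ^ (3 * j) by ring] at this
      simpa only [Nat.div_div_eq_div_mul, mul_assoc] using this

theorem squeeze_unsqueeze (c v : ℕ) (hc : c < p) : squeeze p (unsqueeze p c v) = v := by
  have hp : 0 < p := by omega
  have hp2 : 0 < p ^ 2 := by positivity
  have h1 : v % p ^ 2 < p ^ 2 := Nat.mod_lt _ hp2
  rw [squeeze, unsqueeze, Nat.add_mul_mod_self_left, Nat.mod_mod, pow_succ p 2,
    ← Nat.div_div_eq_div_mul, Nat.add_mul_div_left _ _ hp2, Nat.div_eq_of_lt h1, zero_add,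
    Nat.add_mul_div_left _ _ hp, Nat.div_eq_of_lt hc, zero_add, Nat.mod_add_div]

theorem unsqueeze_div_mod (c v : ℕ) (hc : c < p) : unsqueeze p c v / p ^ 2 % p = c := by
  have hp : 0 < p := by omega
  have hp2 : 0 < p ^ 2 := by positivity
  have h1 : v % p ^ 2 < p ^ 2 := Nat.mod_lt _ hp2
  rw [unsqueeze, Nat.add_mul_div_left _ _ hp2, Nat.div_eq_of_lt h1, zero_add,
    Nat.add_mul_mod_self_left, Nat.mod_eq_of_lt hc]

/-- The deletion is reversible once the digit is known; in the codes of vertices it is the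
conventional u_{1,0}, which the first coordinate determines. -/
theorem unsqueeze_squeeze (hp : 0 < p) (n : ℕ) : unsqueeze p (n / p ^ 2 % p) (squeeze p n) = n := by
  have hp2 : 0 < p ^ 2 := by positivity
  have h1 : n % p ^ 2 < p ^ 2 := Nat.mod_lt _ hp2
  rw [squeeze, unsqueeze, Nat.add_mul_mod_self_left, Nat.mod_mod, Nat.add_mul_div_left _ _ hp2,
    Nat.div_eq_of_lt h1, zero_add, pow_succ p 2, ← Nat.div_div_eq_div_mul, Nat.mod_add_div,
    Nat.mod_add_div]

theorem squeeze_lt {n r : ℕ} (hp : 0 < p) (hn : n < p ^ (3 * (r + 1))) :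
    squeeze p n < p ^ (3 * r + 2) := by
  have hp2 : 0 < p ^ 2 := by positivity
  have h1 : n % p ^ 2 < p ^ 2 := Nat.mod_lt _ hp2
  have h2 : n / p ^ 3 < p ^ (3 * r) := Nat.div_lt_of_lt_mul (hn.trans_eq (by ring))
  calc squeeze p n < p ^ 2 + p ^ 2 * (n / p ^ 3) := by unfold squeeze; omega
    _ = p ^ 2 * (n / p ^ 3 + 1) := by ring
    _ ≤ p ^ 2 * p ^ (3 * r) := Nat.mul_le_mul_left _ h2
    _ = _ := by ring

theorem unsqueeze_lt {v r c : ℕ} (hc : c < p) (hv : v < p ^ (3 * r + 2)) :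
    unsqueeze p c v < p ^ (3 * (r + 1)) := by
  have hp : 0 < p := by omega
  have hp2 : 0 < p ^ 2 := by positivity
  have h1 : v % p ^ 2 < p ^ 2 := Nat.mod_lt _ hp2
  have h2 : v / p ^ 2 < p ^ (3 * r) := Nat.div_lt_of_lt_mul (hv.trans_eq (by ring))
  calc unsqueeze p c v < p ^ 2 + p ^ 2 * (c + p * (v / p ^ 2)) := by unfold unsqueeze; omega
    _ = p ^ 2 * (c + 1 + p * (v / p ^ 2)) := by ring
    _ ≤ p ^ 2 * (p + p * (v / p ^ 2)) := by gcongr; omega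
    _ = p ^ 3 * (v / p ^ 2 + 1) := by ring
    _ ≤ p ^ 3 * p ^ (3 * r) := Nat.mul_le_mul_left _ h2
    _ = _ := by ring

end Digits

/-! ### Numbers of points and lines -/

section Numbering

open PowerSeries

variable {p : ℕ} [Fact p.Prime] {k r d : ℕ}

/-- The nonzero residues `1, …, d`. -/
def colors (p d : ℕ) [Fact p.Prime] : Finset (ZMod p) :=
  (Finset.range d).image fun i => ((i + 1 : ℕ) : ZMod p)

theorem mem_colors (hd : d < p) {x : ZMod p} : x ∈ colors p d ↔ 1 ≤ x.val ∧ x.val ≤ d := by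
  simp only [colors, Finset.mem_image, Finset.mem_range]
  constructor
  · rintro ⟨i, hi, rfl⟩
    rw [ZMod.val_natCast, Nat.mod_eq_of_lt (by omega)]
    omega
  · rintro ⟨h1, h2⟩
    refine ⟨x.val - 1, by omega, ?_⟩
    rw [Nat.sub_add_cancel h1, ZMod.natCast_zmod_val]

theorem zero_notMem_colors (hd : d < p) : (0 : ZMod p) ∉ colors p d := by
  rw [mem_colors hd, ZMod.val_zero]
  omega

theorem card_colors (hd : d < p) : (colors p d).card = d := by
  rw [colors, Finset.card_image_of_injOn, Finset.card_range]
  intro i hi j hj h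
  have := congrArg ZMod.val h
  rw [Finset.coe_range, Set.mem_Iio] at hi hj
  rw [ZMod.val_natCast, ZMod.val_natCast, Nat.mod_eq_of_lt (by omega), Nat.mod_eq_of_lt (by omega)]
    at this
  omega

/-- The digits of a vector whose conventional coordinate `u_{1,0}` is `y`. -/
def vectorCode (r : ℕ) (u : Fin k → ZMod p) (y : ZMod p) : ℕ :=
  code p (fun i => (diag u i).val) (fun i => (up u 0 i).val) (fun i => (down u y i).val) r 1

/-- The number of a vector whose conventional coordinate `u_{1,0}` is `y`. -/
def number (d r : ℕ) (u : Fin k → ZMod p) (y : ZMod p) : ℕ :=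
  ((entry u 0).val - 1) + d * squeeze p (vectorCode r u y)

theorem vectorCode_lt (r : ℕ) (u : Fin k → ZMod p) (y : ZMod p) :
    vectorCode r u y < p ^ (3 * r) :=
  code_lt (fun _ => ZMod.val_lt _) (fun _ => ZMod.val_lt _)
    (fun _ => ZMod.val_lt _) _ _

theorem vectorCode_div_mod (r : ℕ) (u : Fin k → ZMod p) (y : ZMod p) :
    vectorCode (r + 1) u y / p ^ 2 % p = y.val := by
  have hp := NeZero.pos p
  rw [vectorCode, code, pow_two, ← Nat.div_div_eq_div_mul, Nat.add_mul_div_left _ _ hp,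
    Nat.div_eq_of_lt (ZMod.val_lt _), zero_add, Nat.add_mul_div_left _ _ hp,
    Nat.div_eq_of_lt (ZMod.val_lt _), zero_add, Nat.add_mul_mod_self_left,
    Nat.mod_eq_of_lt (ZMod.val_lt _)]
  simp [down]

theorem number_lt (hd : d < p) {u : Fin k → ZMod p} (hu : entry u 0 ∈ colors p d) (r : ℕ)
    (y : ZMod p) : number d (r + 1) u y < d * p ^ (3 * r + 2) := by
  rw [mem_colors hd] at hu
  have := squeeze_lt (NeZero.pos p) (vectorCode_lt (r + 1) u y)
  calc number d (r + 1) u y < d + d * squeeze p (vectorCode (r + 1) u y) := by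
        unfold number; omega
    _ = d * (squeeze p (vectorCode (r + 1) u y) + 1) := by ring
    _ ≤ _ := Nat.mul_le_mul_left _ this

/-- The digits determine three of the four series. Since `diag` has constant coefficient -1 it is
invertible, and the determinant then determines `diag'`. The functions (x, y) are (z, 0) for points
and (0, z) for lines, so one argument covers both sides. -/
theorem number_injective (hk : k + 1 = 4 * (r + 1)) (hd : d < p) {x y : ZMod p → ZMod p}
    {u v : Fin k → ZMod p} (hu : entry u 0 ∈ colors p d) (hv : entry v 0 ∈ colors p d)
    (hdu : toTrunc (ZMod p) (r + 1) (genMat u (x (entry u 0)) (y (entry u 0))).det = -1)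
    (hdv : toTrunc (ZMod p) (r + 1) (genMat v (x (entry v 0)) (y (entry v 0))).det = -1)
    (h : number d (r + 1) u (y (entry u 0)) = number d (r + 1) v (y (entry v 0))) : u = v := by
  have hu' := (mem_colors hd).1 hu
  have hv' := (mem_colors hd).1 hv
  obtain ⟨h0, h1⟩ := add_mul_inj (by omega) (by omega) h
  have h0 : entry u 0 = entry v 0 := ZMod.val_injective _ (by omega)
  rw [← h0] at h1 hdv
  have h2 : vectorCode (r + 1) u (y (entry u 0)) = vectorCode (r + 1) v (y (entry u 0)) := by
    rw [← unsqueeze_squeeze (NeZero.pos p) (vectorCode (r + 1) u _), h1, vectorCode_div_mod,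
      ← vectorCode_div_mod r v, unsqueeze_squeeze (NeZero.pos p)]
  have h3 := code_inj (fun _ => ZMod.val_lt _) (fun _ => ZMod.val_lt _)
    (fun _ => ZMod.val_lt _) (fun _ => ZMod.val_lt _) (fun _ => ZMod.val_lt _)
    (fun _ => ZMod.val_lt _) h2
  have h4 : ∀ i ≤ r + 1, diag u i = diag v i ∧ up u (x (entry u 0)) i = up v (x (entry u 0)) i ∧
      down u (y (entry u 0)) i = down v (y (entry u 0)) i := by
    intro i hi
    rcases i with - | i
    · simp [diag, up, down]
    · obtain ⟨g1, g2, g3⟩ := h3 i (by omega)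
      rw [add_comm 1 i] at g1 g2 g3
      refine ⟨ZMod.val_injective _ g1, ?_, ZMod.val_injective _ g3⟩
      -- The code is formed with x = 0, which affects only the index 0, and that is not among the
      -- digits.
      have := ZMod.val_injective _ g2
      rwa [up, up, if_neg (by omega), if_neg (by omega)] at this ⊢
  refine eq_of_redMat_genMat_eq (x := x (entry u 0)) (y := y (entry u 0)) hk h0 ?_
  have e1 : toTrunc (ZMod p) (r + 1) (mk (diag u)) = toTrunc (ZMod p) (r + 1) (mk (diag v)) :=
    toTrunc_eq_iff.2 fun i hi => by simpa using (h4 i hi).1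
  have e2 : toTrunc (ZMod p) (r + 1) (mk (up u (x (entry u 0)))) =
      toTrunc (ZMod p) (r + 1) (mk (up v (x (entry u 0)))) :=
    toTrunc_eq_iff.2 fun i hi => by simpa using (h4 i hi).2.1
  have e3 : toTrunc (ZMod p) (r + 1) (mk (down u (y (entry u 0)))) =
      toTrunc (ZMod p) (r + 1) (mk (down v (y (entry u 0)))) :=
    toTrunc_eq_iff.2 fun i hi => by simpa using (h4 i hi).2.2
  have hun : IsUnit (toTrunc (ZMod p) (r + 1) (mk (diag v))) := by
    refine IsUnit.map _ ?_
    rw [PowerSeries.isUnit_iff_constantCoeff]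
    simp [diag]
  have e4 : toTrunc (ZMod p) (r + 1) (mk (diag' u)) = toTrunc (ZMod p) (r + 1) (mk (diag' v)) := by
    rw [Matrix.det_fin_two] at hdu hdv
    simp only [genMat, Matrix.of_apply, Matrix.cons_val_zero, Matrix.cons_val_one,
      Matrix.cons_val', Matrix.cons_val_fin_one, map_sub, map_mul] at hdu hdv
    rw [e1, e2, e3] at hdu
    exact hun.mul_left_cancel (sub_left_injective (hdu.trans hdv.symm))
  ext i j
  fin_cases i <;> fin_cases j <;> simp [genMat, e1, e2, e3, e4]

/-- The digits of `N` prescribe the series a, b, c, and ad - bc = -1 forces (bc - 1)a⁻¹ as the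
fourth. Its coefficient at X equals that of a because xy = 0, as `exists_genMat_eq` demands. -/
theorem exists_number_eq (hk : k + 1 = 4 * (r + 1)) (hd : d < p) {x y : ZMod p → ZMod p}
    (hxy : ∀ z, x z * y z = 0) {N : ℕ} (hN : N < d * p ^ (3 * r + 2)) :
    ∃ u : Fin k → ZMod p, entry u 0 ∈ colors p d ∧
      toTrunc (ZMod p) (r + 1) (genMat u (x (entry u 0)) (y (entry u 0))).det = -1 ∧
      number d (r + 1) u (y (entry u 0)) = N := by
  have hp := NeZero.pos p
  have hd0 : 0 < d := Nat.pos_of_ne_zero (by rintro rfl; simp at hN)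
  have hmod := Nat.mod_lt N hd0
  set z : ZMod p := ((N % d + 1 : ℕ) : ZMod p) with hz
  have hzv : z.val = N % d + 1 := by
    rw [hz, ZMod.val_natCast, Nat.mod_eq_of_lt (by omega)]
  set O := unsqueeze p (y z).val (N / d) with hO
  have hOlt : O < p ^ (3 * (r + 1)) :=
    unsqueeze_lt (ZMod.val_lt _) (Nat.div_lt_of_lt_mul hN)
  have hOy : O / p / p % p = (y z).val := by
    rw [Nat.div_div_eq_div_mul, ← pow_two]
    exact unsqueeze_div_mod _ _ (ZMod.val_lt _)
  let a : (ZMod p)⟦X⟧ := mk fun i => if i = 0 then -1 else ((O / p ^ (3 * (i - 1)) % p : ℕ) : ZMod p)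
  let b : (ZMod p)⟦X⟧ := mk fun i => if i = 0 then x z else
    ((O / p ^ (3 * (i - 1)) / p % p : ℕ) : ZMod p)
  let c : (ZMod p)⟦X⟧ := mk fun i => if i = 0 then 0 else
    ((O / p ^ (3 * (i - 1)) / p / p % p : ℕ) : ZMod p)
  have ha0 : constantCoeff a = -1 := by simp [a]
  have hb0 : constantCoeff b = x z := by simp [b]
  have hc0 : constantCoeff c = 0 := by simp [c]
  have hc1 : coeff 1 c = y z := by
    rw [coeff_mk, if_neg one_ne_zero, Nat.sub_self, mul_zero, pow_zero, Nat.div_one, hOy,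
      ZMod.natCast_zmod_val]
  have had : a * ((b * c - 1) * a⁻¹) = b * c - 1 := by
    rw [mul_left_comm, PowerSeries.mul_inv_cancel _ (by rw [ha0]; simp), mul_one]
  have hd0' : constantCoeff ((b * c - 1) * a⁻¹) = 1 := by
    have := congrArg (constantCoeff (R := ZMod p)) had
    rw [map_mul, ha0, map_sub _ (b * c), map_mul _ b, hc0, mul_zero, map_one] at this
    linear_combination -this
  obtain ⟨u, hu0, hu⟩ := exists_genMat_eq hk z (a := a) (b := b) (c := c)
    (d := (b * c - 1) * a⁻¹) (x := x z) (y := y z) (by simpa using ha0) (by simpa using hb0)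
    (by simpa using hc0) hc1 (by simpa using hd0') (by
      have := congrArg (coeff (R := ZMod p) 1) had
      rw [coeff_mul, map_sub, coeff_mul, Finset.Nat.sum_antidiagonal_eq_sum_range_succ_mk,
        Finset.Nat.sum_antidiagonal_eq_sum_range_succ_mk] at this
      simp only [Finset.sum_range_succ, Finset.range_zero, Finset.sum_empty, Nat.sub_zero,
        Nat.sub_self, zero_add, coeff_zero_eq_constantCoeff, hb0, hc0, ha0, hd0', hc1, hxy,
        mul_zero, coeff_one, one_ne_zero, if_false, add_zero, sub_zero, mul_one] at this
      linear_combination this)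
  have hdet : toTrunc (ZMod p) (r + 1) (genMat u (x z) (y z)).det = -1 := by
    rw [← det_redMat, hu, det_redMat, Matrix.det_fin_two_of, had]
    simp
  refine ⟨u, ?_, by rw [hu0]; exact hdet, ?_⟩
  · rw [hu0, mem_colors hd, hzv]
    omega
  · have hcode : vectorCode (r + 1) u (y z) = O := by
      refine code_eq hOlt fun j hj => ?_
      rw [redMat_eq_iff] at hu
      simp only [Fin.forall_fin_two, genMat, Matrix.of_apply, Matrix.cons_val_zero,
        Matrix.cons_val_one, Matrix.cons_val', Matrix.cons_val_fin_one, coeff_mk] at hu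
      obtain ⟨⟨h1, h2⟩, h3, -⟩ := hu
      have h1 := h1 (1 + j) (by omega)
      have h2 := h2 (1 + j) (by omega)
      have h3 := h3 (1 + j) (by omega)
      have h2' : up u 0 (1 + j) = up u (x z) (1 + j) := by
        rw [up, up, if_neg (by omega), if_neg (by omega)]
      simp only [h1, h2', h2, h3, a, b, c, coeff_mk, if_neg (show ¬ 1 + j = 0 by omega),
        ZMod.val_natCast, Nat.mod_mod, show 1 + j - 1 = j by omega, and_self]
    rw [number, hu0, hcode, hO, squeeze_unsqueeze _ _ (ZMod.val_lt _), hzv, Nat.add_sub_cancel,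
      Nat.mod_add_div]

/-- The numbering of the vectors with given first entries and zero certificate. -/
noncomputable def numbering (hk : k + 1 = 4 * (r + 1)) (hd : d < p) {x y : ZMod p → ZMod p}
    (hxy : ∀ z, x z * y z = 0) {Q : (Fin k → ZMod p) → Prop}
    (hQ : ∀ u, Q u ↔
      toTrunc (ZMod p) (r + 1) (genMat u (x (entry u 0)) (y (entry u 0))).det = -1) :
    {u : Fin k → ZMod p // Q u ∧ entry u 0 ∈ colors p d} ≃ Fin (d * p ^ (3 * r + 2)) :=
  Equiv.ofBijective (fun u => ⟨number d (r + 1) u.1 (y (entry u.1 0)), number_lt hd u.2.2 _ _⟩) (by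
    constructor
    · intro u v h
      exact Subtype.ext (number_injective hk hd u.2.2 v.2.2 ((hQ _).1 u.2.1) ((hQ _).1 v.2.1)
        (Fin.val_eq_of_eq h))
    · rintro ⟨N, hN⟩
      obtain ⟨u, h1, h2, h3⟩ := exists_number_eq hk hd hxy hN
      exact ⟨⟨u, (hQ u).2 h2, h1⟩, Fin.ext h3⟩)

variable {d₁ d₂ : ℕ}

/-- The numbering of the points. -/
noncomputable def pointNumbering (hk : k + 1 = 4 * (r + 1)) (hd : d₂ < p) (B : Finset (ZMod p)) :
    (CD k (colors p d₂) B).Left ≃ Fin (d₂ * p ^ (3 * r + 2)) :=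
  numbering hk hd (x := fun z => z) (y := fun _ => 0) (fun _ => mul_zero _)
    (pointCertificateZero_iff hk)

/-- The numbering of the lines. -/
noncomputable def lineNumbering (hk : k + 1 = 4 * (r + 1)) (hd : d₁ < p) (A : Finset (ZMod p)) :
    (CD k A (colors p d₁)).Right ≃ Fin (d₁ * p ^ (3 * r + 2)) :=
  numbering hk hd (x := fun _ => 0) (y := fun z => z) (fun _ => zero_mul _)
    (lineCertificateZero_iff hk)

end Numbering

end LU

/-! ## Loop-free programs -/

namespace Ram

/-- The store with the given contents and zeros elsewhere. -/
def ofList (l : List ℕ) : Store := fun j => l.getD j 0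

/-- The effect of a program without indirect addressing and loops on a store given as a list. -/
def Prog.run : Prog → List ℕ → List ℕ
  | .const a c, l => l.set a c
  | .add a b c, l => l.set a (l.getD b 0 + l.getD c 0)
  | .sub a b c, l => l.set a (l.getD b 0 - l.getD c 0)
  | .mul a b c, l => l.set a (l.getD b 0 * l.getD c 0)
  | .div a b c, l => l.set a (l.getD b 0 / l.getD c 0)
  | .seq p q, l => q.run (p.run l)
  | .ite a p q, l => match l.getD a 0 with
    | 0 => q.run l
    | _ + 1 => p.run l
  | _, l => l

/-- The program has no indirect addressing and no loops and uses only the first `n` cells. -/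
def Prog.IsSimple (n : ℕ) : Prog → Prop
  | .skip => True
  | .const a _ => a < n
  | .add a b c | .sub a b c | .mul a b c | .div a b c => a < n ∧ b < n ∧ c < n
  | .seq p q => p.IsSimple n ∧ q.IsSimple n
  | .ite a p q => a < n ∧ p.IsSimple n ∧ q.IsSimple n
  | _ => False

/-- The programs of a list one after another. -/
def Prog.block : List Prog → Prog
  | [] => .skip
  | p :: t => .seq p (block t)

theorem len_mono {a b : ℕ} (h : a ≤ b) : len a ≤ len b :=
  Nat.add_le_add_right (Nat.log_mono_right h) 1

theorem len_pos (a : ℕ) : 1 ≤ len a := Nat.le_add_left 1 _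

/-- Passing from the bound V on stored numbers to V^g costs only a constant factor, so linear time
bounds compose along `seq`. -/
theorem len_pow_le (V g : ℕ) : len (V ^ g) ≤ (g + 1) * len V := by
  have : Nat.log 2 (V ^ g) < g * len V + 1 := by
    refine Nat.log_lt_of_lt_pow' (by omega) ?_
    rw [Nat.pow_succ]
    have h1 : V ^ g ≤ 2 ^ (g * len V) := by
      rw [mul_comm, pow_mul]
      exact Nat.pow_le_pow_left (Nat.lt_pow_succ_log_self (by norm_num) V).le g
    have h2 : 0 < 2 ^ (g * len V) := by positivity
    omega
  have := len_pos V
  rw [add_mul, one_mul]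
  unfold len at *
  omega

theorem update_ofList {n : ℕ} {l : List ℕ} (hl : l.length = n) {a : ℕ} (ha : a < n) (v : ℕ) :
    Function.update (ofList l) a v = ofList (l.set a v) := by
  funext j
  simp only [Function.update_apply, ofList, List.getD_eq_getElem?_getD, List.getElem?_set]
  subst hl
  by_cases h : j = a
  · subst h
    simp [ha]
  · simp [h, Ne.symm h]

theorem getD_le {l : List ℕ} {V : ℕ} (h : ∀ x ∈ l, x ≤ V) (j : ℕ) : l.getD j 0 ≤ V := by
  rw [List.getD_eq_getElem?_getD]
  by_cases hj : j < l.length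
  · simpa [hj] using h _ (List.getElem_mem hj)
  · simp [hj]

theorem set_le {l : List ℕ} {V v : ℕ} (h : ∀ x ∈ l, x ≤ V) (hv : v ≤ V) (a : ℕ) :
    ∀ x ∈ l.set a v, x ≤ V := by
  intro x hx
  rcases List.mem_or_eq_of_mem_set hx with hx | rfl
  · exact h x hx
  · exact hv

theorem arithCost_le {n V : ℕ} {l : List ℕ} (hn : n ≤ V) (h : ∀ x ∈ l, x ≤ V) {a b c : ℕ}
    (ha : a < n) (hb : b < n) (hc : c < n) : arithCost (ofList l) a b c ≤ 5 * len V := by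
  have h1 := len_mono (ha.le.trans hn)
  have h2 := len_mono (hb.le.trans hn)
  have h3 := len_mono (hc.le.trans hn)
  have h4 := len_mono (getD_le h b)
  have h5 := len_mono (getD_le h c)
  unfold arithCost ofList
  omega

/-- A loop-free program runs in time linear in the lengths of the numbers in the store and
enlarges these lengths at most by a constant factor. -/
theorem exists_exec_of_isSimple {n : ℕ} {P : Prog} (hP : P.IsSimple n) :
    ∃ V₀ K g : ℕ, 0 < g ∧ ∀ V, V₀ ≤ V → ∀ l : List ℕ, l.length = n → (∀ x ∈ l, x ≤ V) →
      (P.run l).length = n ∧ (∀ x ∈ P.run l, x ≤ V ^ g) ∧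
      ∃ s ≤ K * len V, Exec P (ofList l) (ofList (P.run l)) s := by
  -- One argument for the four arithmetic instructions: results are at most V², and n ≤ V bounds the
  -- addresses.
  have arith : ∀ (f : ℕ → ℕ → ℕ) (op : ℕ → ℕ → ℕ → Prog),
      (∀ a b c l, (op a b c).run l = l.set a (f (l.getD b 0) (l.getD c 0))) →
      (∀ a b c σ, Exec (op a b c) σ (Function.update σ a (f (σ b) (σ c))) (arithCost σ a b c)) →
      (∀ V x y, 2 ≤ V → x ≤ V → y ≤ V → f x y ≤ V ^ 2) → ∀ a b c, a < n ∧ b < n ∧ c < n →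
      ∃ V₀ K g : ℕ, 0 < g ∧ ∀ V, V₀ ≤ V → ∀ l : List ℕ, l.length = n → (∀ x ∈ l, x ≤ V) →
      ((op a b c).run l).length = n ∧ (∀ x ∈ (op a b c).run l, x ≤ V ^ g) ∧
      ∃ s ≤ K * len V, Exec (op a b c) (ofList l) (ofList ((op a b c).run l)) s := by
    rintro f op hrun hexec hf a b c ⟨ha, hb, hc⟩
    refine ⟨n + 2, 5, 2, by norm_num, fun V hV l hl h => ?_⟩
    rw [hrun]
    refine ⟨by simpa using hl, set_le (fun x hx => (h x hx).trans (Nat.le_self_pow (by norm_num) V))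
      (hf V _ _ (by omega) (getD_le h b) (getD_le h c)) a, _,
      arithCost_le (V := V) (by omega) h ha hb hc, ?_⟩
    rw [← update_ofList hl ha]
    exact hexec a b c _
  induction P with
  | skip =>
    refine ⟨0, 1, 1, by norm_num, fun V _ l hl h => ⟨hl, by simpa [Prog.run] using h, 1, ?_, ?_⟩⟩
    · simpa using len_pos V
    · exact Exec.skip _
  | const a c =>
    have ha : a < n := hP
    refine ⟨n + c, 2, 1, by norm_num, fun V hV l hl h => ?_⟩
    refine ⟨by simpa [Prog.run] using hl, ?_, len a + len c, ?_, ?_⟩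
    · rw [pow_one]
      exact set_le h (by omega) a
    · have h1 := len_mono (show a ≤ V by omega)
      have h2 := len_mono (show c ≤ V by omega)
      omega
    · rw [Prog.run, ← update_ofList hl ha]
      exact Exec.const _ _ _
  | add a b c =>
    refine arith (· + ·) .add (fun _ _ _ _ => rfl) (fun a b c σ => Exec.add σ a b c) ?_ a b c hP
    intro V x y hV hx hy
    calc x + y ≤ 2 * V := by omega
      _ ≤ V * V := Nat.mul_le_mul_right _ hV
      _ = V ^ 2 := by ring
  | sub a b c =>
    refine arith (· - ·) .sub (fun _ _ _ _ => rfl) (fun a b c σ => Exec.sub σ a b c) ?_ a b c hP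
    intro V x y hV hx hy
    exact (Nat.sub_le x y).trans (hx.trans (Nat.le_self_pow (by norm_num) V))
  | mul a b c =>
    refine arith (· * ·) .mul (fun _ _ _ _ => rfl) (fun a b c σ => Exec.mul σ a b c) ?_ a b c hP
    intro V x y hV hx hy
    exact (Nat.mul_le_mul hx hy).trans_eq (by ring)
  | div a b c =>
    refine arith (· / ·) .div (fun _ _ _ _ => rfl) (fun a b c σ => Exec.div σ a b c) ?_ a b c hP
    intro V x y hV hx hy
    exact (Nat.div_le_self x y).trans (hx.trans (Nat.le_self_pow (by norm_num) V))
  | load a b => exact hP.elim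
  | store a b => exact hP.elim
  | loop a p => exact hP.elim
  | seq p q ihp ihq =>
    obtain ⟨V₁, K₁, g₁, hg₁, h₁⟩ := ihp hP.1
    obtain ⟨V₂, K₂, g₂, hg₂, h₂⟩ := ihq hP.2
    refine ⟨V₁ + V₂, K₁ + K₂ * (g₁ + 1), g₁ * g₂, Nat.mul_pos hg₁ hg₂, fun V hV l hl h => ?_⟩
    obtain ⟨a1, a2, s, hs, a3⟩ := h₁ V (by omega) l hl h
    obtain ⟨b1, b2, t, ht, b3⟩ := h₂ (V ^ g₁)
      ((show V₂ ≤ V by omega).trans (Nat.le_self_pow hg₁.ne' V)) (p.run l) a1 a2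
    refine ⟨b1, fun x hx => by rw [pow_mul]; exact b2 x hx, s + t, ?_, Exec.seq a3 b3⟩
    have := Nat.mul_le_mul_left K₂ (len_pow_le V g₁)
    calc s + t ≤ K₁ * len V + K₂ * ((g₁ + 1) * len V) := by omega
      _ = _ := by ring
  | ite a p q ihp ihq =>
    obtain ⟨V₁, K₁, g₁, hg₁, h₁⟩ := ihp hP.2.1
    obtain ⟨V₂, K₂, g₂, hg₂, h₂⟩ := ihq hP.2.2
    refine ⟨V₁ + V₂ + n + 1, K₁ + K₂ + 2, g₁ + g₂, by omega, fun V hV l hl h => ?_⟩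
    have hV1 : 1 ≤ V := by omega
    have htest : testCost (ofList l) a ≤ 2 * len V := by
      have h1 := len_mono (show a ≤ V by have := hP.1; omega)
      have h2 := len_mono (getD_le h a)
      unfold testCost ofList
      omega
    have hexp : (K₁ + K₂ + 2) * len V = K₁ * len V + K₂ * len V + 2 * len V := by ring
    rcases hm : l.getD a 0 with - | z
    · obtain ⟨b1, b2, t, ht, b3⟩ := h₂ V (by omega) l hl h
      have hrun : (Prog.ite a p q).run l = q.run l := by
        simp only [Prog.run, hm]
      rw [hrun]
      exact ⟨b1, fun x hx => (b2 x hx).trans (Nat.pow_le_pow_right hV1 (by omega)), _, by omega,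
        Exec.iteFalse hm b3⟩
    · obtain ⟨b1, b2, t, ht, b3⟩ := h₁ V (by omega) l hl h
      have hrun : (Prog.ite a p q).run l = p.run l := by
        simp only [Prog.run, hm]
      rw [hrun]
      exact ⟨b1, fun x hx => (b2 x hx).trans (Nat.pow_le_pow_right hV1 (by omega)), _, by omega,
        Exec.iteTrue (by rw [ofList, hm]; omega) b3⟩

/-- Running a loop through a given sequence of stores. -/
theorem exec_loop {n V K a N : ℕ} {P : Prog} (ha : a ≤ V)
    (hP : ∀ l : List ℕ, l.length = n → (∀ x ∈ l, x ≤ V) →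
      ∃ s ≤ K * len V, Exec P (ofList l) (ofList (P.run l)) s)
    (L : ℕ → List ℕ) (hlen : ∀ j ≤ N, (L j).length = n) (hV : ∀ j ≤ N, ∀ x ∈ L j, x ≤ V)
    (hrun : ∀ j < N, P.run (L j) = L (j + 1)) (ha0 : ∀ j < N, (L j).getD a 0 ≠ 0)
    (haN : (L N).getD a 0 = 0) :
    ∃ s ≤ (N + 1) * ((K + 2) * len V), Exec (.loop a P) (ofList (L 0)) (ofList (L N)) s := by
  have htest : ∀ j ≤ N, testCost (ofList (L j)) a ≤ 2 * len V := by
    intro j hj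
    have h1 := len_mono ha
    have h2 := len_mono (getD_le (hV j hj) a)
    unfold testCost ofList
    omega
  -- Induction on the number of rounds still to come, since `loopStep` peels off the first round.
  have key : ∀ i ≤ N, ∃ s ≤ (i + 1) * ((K + 2) * len V),
      Exec (.loop a P) (ofList (L (N - i))) (ofList (L N)) s := by
    intro i
    induction i with
    | zero =>
      intro _
      refine ⟨_, ?_, Exec.loopStop haN⟩
      have := htest N le_rfl
      calc _ ≤ 2 * len V := this
        _ ≤ K * len V + 2 * len V := Nat.le_add_left _ _
        _ = _ := by ring
    | succ i ih =>
      intro hi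
      obtain ⟨s, hs, he⟩ := ih (by omega)
      obtain ⟨t, ht, hb⟩ := hP (L (N - (i + 1))) (hlen _ (by omega)) (hV _ (by omega))
      rw [hrun _ (by omega), show N - (i + 1) + 1 = N - i by omega] at hb
      refine ⟨_, ?_, Exec.loopStep (ha0 _ (by omega)) hb he⟩
      have := htest (N - (i + 1)) (by omega)
      calc _ ≤ 2 * len V + K * len V + (i + 1) * ((K + 2) * len V) := by omega
        _ = _ := by ring
  simpa using key N le_rfl

/-- A loop between two loop-free programs, running through a given sequence of stores. -/
theorem exists_computesIn {n a : ℕ} {P Q R : Prog} (hP : P.IsSimple n) (hQ : Q.IsSimple n)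
    (hR : R.IsSimple n) : ∃ V₀ K : ℕ, ∀ V, V₀ ≤ V → ∀ (N : ℕ) (input l : List ℕ) (L : ℕ → List ℕ),
      ofList input = ofList l → l.length = n → (∀ x ∈ l, x ≤ V) → P.run l = L 0 →
      (∀ j ≤ N, (L j).length = n) → (∀ j ≤ N, ∀ x ∈ L j, x ≤ V) →
      (∀ j < N, Q.run (L j) = L (j + 1)) → (∀ j < N, (L j).getD a 0 ≠ 0) →
      (L N).getD a 0 = 0 →
      (Prog.seq P (.seq (.loop a Q) R)).ComputesIn input ((R.run (L N)).getD 0 0)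
        (K * ((N + 1) * len V)) := by
  obtain ⟨V₁, K₁, g₁, -, h₁⟩ := exists_exec_of_isSimple hP
  obtain ⟨V₂, K₂, g₂, -, h₂⟩ := exists_exec_of_isSimple hQ
  obtain ⟨V₃, K₃, g₃, -, h₃⟩ := exists_exec_of_isSimple hR
  refine ⟨V₁ + V₂ + V₃ + a, K₁ + (K₂ + 2) + K₃, ?_⟩
  intro V hV N input l L hin hl hlV hrun hlen hLV hstep ha0 haN
  obtain ⟨-, -, s, hs, e1⟩ := h₁ V (by omega) l hl hlV
  obtain ⟨t, ht, e2⟩ := exec_loop (n := n) (V := V) (K := K₂) (a := a) (N := N) (P := Q) (by omega)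
    (fun l hl h => (h₂ V (by omega) l hl h).2.2) L hlen hLV hstep ha0 haN
  obtain ⟨-, -, w, hw, e3⟩ := h₃ V (by omega) (L N) (hlen N le_rfl) (hLV N le_rfl)
  rw [hrun, ← hin] at e1
  refine ⟨_, _, Exec.seq e1 (Exec.seq e2 e3), ?_, rfl⟩
  have h1 : K₁ * len V ≤ K₁ * ((N + 1) * len V) :=
    Nat.mul_le_mul_left _ (Nat.le_mul_of_pos_left _ (by omega))
  have h3 : K₃ * len V ≤ K₃ * ((N + 1) * len V) :=
    Nat.mul_le_mul_left _ (Nat.le_mul_of_pos_left _ (by omega))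
  calc s + (t + w) ≤ K₁ * ((N + 1) * len V) + ((N + 1) * ((K₂ + 2) * len V) +
        K₃ * ((N + 1) * len V)) := by omega
    _ = _ := by ring

end Ram

/-! ## The program that computes neighbours -/

namespace Ram

namespace Prog

/-- Reduce cell `c` modulo cell `4`. -/
def reduce (c : ℕ) : List Prog := [div 27 c 4, mul 27 27 4, sub c c 27]

/-- Move the last base `p` digit of cell `2` to cell `c`. -/
def readDigit (c : ℕ) : List Prog := [div 27 2 4, mul c 27 4, sub c 2 c, add 2 27 28]

/-- Write cell `c` as the next digit of the output. -/
def writeDigit (c : ℕ) : List Prog := [mul 27 19 c, add 18 18 27, mul 19 19 4]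

/-- Cell `a` becomes `b * e + f` modulo `p`. -/
def mulAdd (a b e f : ℕ) : List Prog := [mul a b e, add a a f] ++ reduce a

/-- Read three digits and extend the numbers which encode the power series. -/
def readBlock : Prog :=
  block (readDigit 23 ++ readDigit 24 ++ readDigit 25 ++
    [mul 27 23 6, add 7 7 27, mul 27 24 6, add 9 9 27, mul 27 25 6, add 10 10 27])

/-- Compute the next coefficient of the dependent power series. -/
def convBlock : Prog :=
  -- As a_0 = -1, the determinant equation reads d_{j+1} = Σ_{i≥1} a_i d_{j+1-i} - Σ b_i c_{j+1-i}.
  -- Each sum is a base W digit of a product, and cell 20 holds p - 1 in place of -1.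
  block ([mul 26 7 8, div 26 26 6, div 27 26 5, mul 27 27 5, sub 26 26 27,
    mul 29 9 10, div 29 29 6, div 27 29 5, mul 27 27 5, sub 29 29 27,
    mul 29 29 20, add 26 26 29] ++ reduce 26 ++ [mul 27 26 6, add 8 8 27, mul 6 6 5])

/-- Multiply by three elementary matrices. -/
def matrixBlock : Prog :=
  block (mulAdd 11 11 15 23 ++ mulAdd 12 12 15 25 ++ mulAdd 30 11 16 24 ++ mulAdd 31 12 16 26 ++
    mulAdd 13 13 17 11 ++ mulAdd 14 14 17 12)

/-- Write three digits and prepare the next round. -/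
def writeBlock : Prog :=
  block (writeDigit 13 ++ writeDigit 30 ++ writeDigit 14 ++
    [add 11 24 28, add 12 26 28, add 13 30 28, add 14 31 28, sub 0 0 21,
      const 23 0, const 24 0, const 25 0, const 26 0, const 27 0, const 29 0, const 30 0,
      const 31 0])

/-- One round of the computation of a neighbour. -/
def nbrBody : Prog := block [readBlock, convBlock, matrixBlock, writeBlock]

/-- The initialisation of the computation of a neighbour. -/
def nbrInit (p d₁ d₂ : ℕ) : Prog :=
  block [const 4 p, const 20 (p - 1), const 21 1,
    ite 1 (block [const 23 d₁, const 22 d₂]) (block [const 23 d₂, const 22 d₁]),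
    div 27 2 23, mul 25 27 23, sub 24 2 25, add 24 24 21, add 25 3 21,
    -- The parameters (s₁, s₂, s₃) are (i + 1, p₁, 0) for a point and (0, -(i + 1), -l₁) for a line,
    -- as in `incident_iff_line` and `incident_iff_point`.
    ite 1 (block [add 26 24 28, add 13 25 28, sub 16 4 25, sub 17 4 24])
      (block [add 11 24 28, add 15 25 28, add 16 24 28]),
    const 12 1, const 14 1,
    -- The deleted digit of weight p² is reinserted; cell 26 holds 0 for a point and l₁ for a line.
    mul 29 4 4, div 30 27 29, mul 31 30 29, sub 27 27 31, mul 30 30 4, add 30 30 26,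
    mul 30 30 29, add 2 27 30,
    -- The base W = ((m + 4)p)² exceeds every coefficient of the packed products.
    const 30 4, add 30 30 0, mul 30 30 4, mul 5 30 30, add 6 5 28,
    const 7 (p - 1), const 8 1, add 9 11 28, const 19 1, const 30 2, add 0 0 30,
    const 23 0, const 24 0, const 25 0, const 26 0, const 27 0, const 29 0, const 30 0,
    const 31 0]

/-- The assembly of the number of the neighbour. -/
def nbrFinal : Prog :=
  block [mul 23 4 4, div 24 18 23, mul 25 24 23, sub 18 18 25, div 24 24 4, mul 24 24 23,
    add 18 18 24, mul 18 18 22, add 0 18 3]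

/-- The program that computes the sizes of the two sides. -/
def size (p d₁ d₂ : ℕ) : Prog :=
  seq (block [const 2 (p ^ 3), const 4 1, ite 1 (const 3 (d₁ * p ^ 5)) (const 3 (d₂ * p ^ 5))])
    (seq (loop 0 (block [mul 3 3 2, sub 0 0 4])) (add 0 3 0))

/-- The program that computes the number of a neighbour. -/
def nbr (p d₁ d₂ : ℕ) : Prog := seq (nbrInit p d₁ d₂) (seq (loop 0 nbrBody) nbrFinal)

theorem isSimple_nbrInit (p d₁ d₂ : ℕ) : (nbrInit p d₁ d₂).IsSimple 32 := by
  simp [nbrInit, block, IsSimple]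

theorem isSimple_nbrBody : nbrBody.IsSimple 32 := by
  simp [nbrBody, block, IsSimple, readBlock, convBlock, matrixBlock, writeBlock, reduce, mulAdd,
    readDigit, writeDigit]

theorem isSimple_nbrFinal : nbrFinal.IsSimple 32 := by
  simp [nbrFinal, block, IsSimple]

theorem nbrBody_run (l : List ℕ) : nbrBody.run l =
    writeBlock.run (matrixBlock.run (convBlock.run (readBlock.run l))) := by
  simp only [nbrBody, block, run]

/-! ### The effect of the blocks on the store -/

section Run

variable {x0 x1 x2 x3 x4 x5 x6 x7 x8 x9 x10 x11 x12 x13 x14 x15 x16 x17 x18 x19 x20 x21 x22 : ℕ}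
  {a b c d a₁ c₁ b' d' a' c' y₁ y₂ y₃ z7 z8 z9 z10 e₁ e₂ m₁ m₂ t o₁ o₂ o₃ t₀ t₁ t₂ t₃ t₄ t₅ : ℕ}

/-- Layout of the cells: 0 rounds left; 2 unread digits; 4 and 5 the bases p and W; 6 the current
power of W; 7–10 the packed series a, d, b, c; 11–14 the last coefficients of the old and the new
second column; 15–17 the parameters; 18 and 19 the output and its next weight; 22 the degree for the
output number; from 23 on scratch, where cell 28 stays 0, so that adding it copies. Results are
named by equations so that the intended residues can be substituted for them. -/
theorem readBlock_run (ha : a = x2 - x2 / x4 * x4) (hy₁ : y₁ = x2 / x4)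
    (hb : b = y₁ - y₁ / x4 * x4) (hy₂ : y₂ = y₁ / x4) (hc : c = y₂ - y₂ / x4 * x4)
    (hy₃ : y₃ = y₂ / x4) (h7 : z7 = x7 + a * x6) (h9 : z9 = x9 + b * x6)
    (h10 : z10 = x10 + c * x6) :
    readBlock.run [x0, x1, x2, x3, x4, x5, x6, x7, x8, x9, x10, x11, x12, x13, x14, x15, x16, x17,
      x18, x19, x20, x21, x22, 0, 0, 0, 0, 0, 0, 0, 0, 0] =
    [x0, x1, y₃, x3, x4, x5, x6, z7, x8, z9, z10, x11, x12, x13, x14, x15, x16, x17,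
      x18, x19, x20, x21, x22, a, b, c, 0, c * x6, 0, 0, 0, 0] := by
  subst ha hy₁ hb hy₂ hc hy₃ h7 h9 h10
  simp only [readBlock, block, run, readDigit, List.cons_append, List.nil_append,
    List.set_cons_succ, List.set_cons_zero, List.getD_cons_succ, List.getD_cons_zero, add_zero]

theorem convBlock_run {w : ℕ} (he₁ : e₁ = x7 * x8 / x6) (hm₁ : m₁ = e₁ - e₁ / x5 * x5)
    (he₂ : e₂ = x9 * x10 / x6) (hm₂ : m₂ = e₂ - e₂ / x5 * x5)
    (ht : t = m₁ + m₂ * x20) (hd : d = t - t / x4 * x4) (h8 : z8 = x8 + d * x6) :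
    convBlock.run [x0, x1, x2, x3, x4, x5, x6, x7, x8, x9, x10, x11, x12, x13, x14, x15, x16, x17,
      x18, x19, x20, x21, x22, a, b, c, 0, w, 0, 0, 0, 0] =
    [x0, x1, x2, x3, x4, x5, x6 * x5, x7, z8, x9, x10, x11, x12, x13, x14, x15, x16, x17,
      x18, x19, x20, x21, x22, a, b, c, d, d * x6, 0, m₂ * x20, 0, 0] := by
  subst he₁ hm₁ he₂ hm₂ ht hd h8
  simp only [convBlock, block, run, reduce, List.cons_append, List.nil_append,
    List.set_cons_succ, List.set_cons_zero, List.getD_cons_succ, List.getD_cons_zero]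

theorem matrixBlock_run {w w' : ℕ} (h0 : t₀ = x11 * x15 + a) (ha₁ : a₁ = t₀ - t₀ / x4 * x4)
    (h1 : t₁ = x12 * x15 + c) (hc₁ : c₁ = t₁ - t₁ / x4 * x4)
    (h2 : t₂ = a₁ * x16 + b) (hb' : b' = t₂ - t₂ / x4 * x4)
    (h3 : t₃ = c₁ * x16 + d) (hd' : d' = t₃ - t₃ / x4 * x4)
    (h4 : t₄ = x13 * x17 + a₁) (ha' : a' = t₄ - t₄ / x4 * x4)
    (h5 : t₅ = x14 * x17 + c₁) (hc' : c' = t₅ - t₅ / x4 * x4) :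
    matrixBlock.run [x0, x1, x2, x3, x4, x5, x6, x7, x8, x9, x10, x11, x12, x13, x14, x15, x16,
      x17, x18, x19, x20, x21, x22, a, b, c, d, w, 0, w', 0, 0] =
    [x0, x1, x2, x3, x4, x5, x6, x7, x8, x9, x10, a₁, c₁, a', c', x15, x16, x17,
      x18, x19, x20, x21, x22, a, b, c, d, t₅ / x4 * x4, 0, w', b', d'] := by
  subst h0 ha₁ h1 hc₁ h2 hb' h3 hd' h4 ha' h5 hc'
  simp only [matrixBlock, block, run, reduce, mulAdd, List.cons_append, List.nil_append,
    List.set_cons_succ, List.set_cons_zero, List.getD_cons_succ, List.getD_cons_zero]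

theorem writeBlock_run {w w' : ℕ} (ho₁ : o₁ = x18 + x19 * a') (ho₂ : o₂ = o₁ + x19 * x4 * b')
    (ho₃ : o₃ = o₂ + x19 * x4 * x4 * c') :
    writeBlock.run [x0, x1, x2, x3, x4, x5, x6, x7, x8, x9, x10, a₁, c₁, a', c', x15, x16,
      x17, x18, x19, x20, x21, x22, a, b, c, d, w, 0, w', b', d'] =
    [x0 - x21, x1, x2, x3, x4, x5, x6, x7, x8, x9, x10, b, d, b', d', x15, x16, x17,
      o₃, x19 * x4 * x4 * x4, x20, x21, x22, 0, 0, 0, 0, 0, 0, 0, 0, 0] := by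
  subst ho₁ ho₂ ho₃
  simp only [writeBlock, block, run, writeDigit, List.cons_append, List.nil_append,
    List.set_cons_succ, List.set_cons_zero, List.getD_cons_succ, List.getD_cons_zero, add_zero]

theorem nbrInit_run_zero {p d₁ d₂ m v i q O W : ℕ} (hx : x0 = v - v / d₂ * d₂ + 1)
    (hq : q = v / d₂) (hO : O = q - q / (p * p) * (p * p) + q / (p * p) * p * (p * p))
    (hW : W = (4 + m) * p * ((4 + m) * p)) :
    (nbrInit p d₁ d₂).run ([m, 0, v, i] ++ List.replicate 28 0) =
    [m + 2, 0, O, i, p, W, W, p - 1, 1, x0, 0, x0, 1, 0, 1, i + 1, x0, 0, 0, 1, p - 1, 1, d₁,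
      0, 0, 0, 0, 0, 0, 0, 0, 0] := by
  subst hx hq hO hW
  simp only [nbrInit, block, run, List.replicate, List.cons_append, List.nil_append,
    List.set_cons_succ, List.set_cons_zero, List.getD_cons_succ, List.getD_cons_zero, add_zero]

theorem nbrInit_run_one {p d₁ d₂ m v i q O W : ℕ} (hx : x0 = v - v / d₁ * d₁ + 1)
    (hq : q = v / d₁) (hO : O = q - q / (p * p) * (p * p) + (q / (p * p) * p + x0) * (p * p))
    (hW : W = (4 + m) * p * ((4 + m) * p)) :
    (nbrInit p d₁ d₂).run ([m, 1, v, i] ++ List.replicate 28 0) =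
    [m + 2, 1, O, i, p, W, W, p - 1, 1, 0, 0, 0, 1, i + 1, 1, 0, p - (i + 1), p - x0, 0, 1, p - 1,
      1, d₂, 0, 0, 0, 0, 0, 0, 0, 0, 0] := by
  subst hx hq hO hW
  simp only [nbrInit, block, run, List.replicate, List.cons_append, List.nil_append,
    List.set_cons_succ, List.set_cons_zero, List.getD_cons_succ, List.getD_cons_zero, add_zero]

theorem nbrFinal_run : (nbrFinal.run [x0, x1, x2, x3, x4, x5, x6, x7, x8, x9, x10, x11, x12, x13,
      x14, x15, x16, x17, x18, x19, x20, x21, x22, 0, 0, 0, 0, 0, 0, 0, 0, 0]).getD 0 0 =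
    (x18 - x18 / (x4 * x4) * (x4 * x4) + x18 / (x4 * x4) / x4 * (x4 * x4)) * x22 + x3 := by
  simp only [nbrFinal, block, run, List.set_cons_succ, List.set_cons_zero, List.getD_cons_succ,
    List.getD_cons_zero]

end Run

end Prog

end Ram

namespace Ram

open LU Finset.Nat

theorem sub_div_mul_self (x y : ℕ) : x - x / y * y = x % y := by
  rw [Nat.mod_def, mul_comm]

/-! ## Kronecker substitution -/

section Pack

open Polynomial

theorem coeff_le_eval_one (P : ℕ[X]) (t : ℕ) : P.coeff t ≤ P.eval 1 := by
  by_cases ht : t ∈ Finset.range (P.natDegree + 1)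
  · rw [eval_eq_sum_range]
    simp only [one_pow, mul_one]
    exact Finset.single_le_sum (f := fun i => P.coeff i) (fun _ _ => Nat.zero_le _) ht
  · rw [coeff_eq_zero_of_natDegree_lt]
    · exact Nat.zero_le _
    · simpa using ht

/-- Coefficients below W cause no carries, so they are the base W digits of the value at W. -/
theorem eval_div_pow_mod {W : ℕ} (t : ℕ) {P : ℕ[X]} (hP : ∀ i, P.coeff i < W) :
    P.eval W / W ^ t % W = P.coeff t := by
  have hW : 0 < W := (Nat.zero_le _).trans_lt (hP 0)
  induction t generalizing P with
  | zero =>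
    nth_rewrite 1 [← X_mul_divX_add P]
    simp [Nat.mod_eq_of_lt (hP 0)]
  | succ t ih =>
    have h := ih (P := P.divX) (fun i => by rw [coeff_divX]; exact hP _)
    rw [coeff_divX] at h
    rw [← h]
    nth_rewrite 1 [← X_mul_divX_add P]
    rw [pow_succ', ← Nat.div_div_eq_div_mul]
    simp [Nat.mul_add_div hW, Nat.div_eq_of_lt (hP 0)]

variable {p : ℕ}

/-- The polynomial with the given residues as its first coefficients. -/
noncomputable def packPoly (f : ℕ → ZMod p) (n : ℕ) : ℕ[X] :=
  ∑ i ∈ Finset.range (n + 1), C (f i).val * X ^ i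

/-- The number with the given residues as its base `W` digits. -/
def pack (W : ℕ) (f : ℕ → ZMod p) (n : ℕ) : ℕ := ∑ i ∈ Finset.range (n + 1), (f i).val * W ^ i

theorem eval_packPoly (W : ℕ) (f : ℕ → ZMod p) (n : ℕ) : (packPoly f n).eval W = pack W f n := by
  simp [packPoly, pack, eval_finsetSum]

theorem pack_succ (W : ℕ) (f : ℕ → ZMod p) (n : ℕ) :
    pack W f (n + 1) = pack W f n + (f (n + 1)).val * W ^ (n + 1) := by
  rw [pack, Finset.sum_range_succ, pack]

variable [Fact p.Prime]

theorem coeff_packPoly (f : ℕ → ZMod p) (n i : ℕ) :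
    (((packPoly f n).coeff i : ℕ) : ZMod p) = if i ≤ n then f i else 0 := by
  simp only [packPoly, finsetSum_coeff, coeff_C_mul, coeff_X_pow, mul_ite, mul_one, mul_zero,
    Finset.sum_ite_eq, Finset.mem_range, Nat.lt_succ_iff]
  split_ifs <;> simp

theorem pack_one_lt (f : ℕ → ZMod p) (n : ℕ) : pack 1 f n < p * (n + 1) := by
  calc pack 1 f n < ∑ i ∈ Finset.range (n + 1), p := by
        refine Finset.sum_lt_sum_of_nonempty ⟨0, by simp⟩ fun i _ => ?_
        simpa using ZMod.val_lt (f i)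
    _ = _ := by simp [mul_comm]

/-- Coefficients of the product are at most its value at 1, hence below (p(N + 1))² ≤ W. Separate
cut-offs allow one factor to lack its next, still unknown coefficient. -/
theorem pack_mul_digit {W N n₁ n₂ : ℕ} (f g : ℕ → ZMod p) (h₁ : n₁ ≤ N) (h₂ : n₂ ≤ N)
    (hW : (p * (N + 1)) * (p * (N + 1)) ≤ W) (t : ℕ) :
    ((pack W f n₁ * pack W g n₂ / W ^ t % W : ℕ) : ZMod p) = ∑ x ∈ Finset.HasAntidiagonal.antidiagonal t,
      (if x.1 ≤ n₁ then f x.1 else 0) * (if x.2 ≤ n₂ then g x.2 else 0) := by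
  rw [← eval_packPoly, ← eval_packPoly, ← eval_mul, eval_div_pow_mod, coeff_mul]
  · push_cast
    simp only [coeff_packPoly]
  · intro i
    refine (coeff_le_eval_one _ _).trans_lt ?_
    rw [eval_mul, eval_packPoly, eval_packPoly]
    refine lt_of_lt_of_le (Nat.mul_lt_mul'' ((pack_one_lt f n₁).trans_le ?_)
      ((pack_one_lt g n₂).trans_le ?_)) hW <;>
    exact Nat.mul_le_mul_left _ (by omega)

theorem pack_lt {W : ℕ} (hW : p ≤ W) (f : ℕ → ZMod p) (n : ℕ) : pack W f n < W ^ (n + 1) := by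
  induction n with
  | zero => simpa [pack] using (ZMod.val_lt (f 0)).trans_le hW
  | succ n ih =>
    have h := (ZMod.val_lt (f (n + 1))).trans_le hW
    calc pack W f (n + 1) < W ^ (n + 1) + (f (n + 1)).val * W ^ (n + 1) := by
          rw [pack_succ]; omega
      _ = ((f (n + 1)).val + 1) * W ^ (n + 1) := by ring
      _ ≤ W * W ^ (n + 1) := Nat.mul_le_mul_right _ h
      _ = _ := by ring

end Pack

/-! ## The rounds of the computation -/

section Rounds

variable {p : ℕ} [Fact p.Prime]

/-- The first `r` coefficients of the power series of adjacent vertices determine each other. -/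
structure Transforms (r : ℕ) (s₁ s₂ s₃ : ℕ) (a b c d a' b' c' d' : ℕ → ZMod p) : Prop where
  a_zero : a 0 = -1
  c_zero : c 0 = 0
  d_zero : d 0 = 1
  d'_zero : d' 0 = 1
  det : ∀ j < r, ∑ x ∈ Finset.HasAntidiagonal.antidiagonal (j + 1), a x.1 * d x.2 =
    ∑ x ∈ Finset.HasAntidiagonal.antidiagonal (j + 1), b x.1 * c x.2
  a' : ∀ j < r, a' (j + 1) = a (j + 1) + s₁ * b j + s₃ * b' j
  b' : ∀ j < r, b' (j + 1) = b (j + 1) + s₂ * (a (j + 1) + s₁ * b j)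
  c' : ∀ j < r, c' (j + 1) = c (j + 1) + s₁ * d j + s₃ * d' j
  d' : ∀ j < r, d' (j + 1) = d (j + 1) + s₂ * (c (j + 1) + s₁ * d j)

/-- `code` unfolds from the lowest block, as digits are read; the output grows by a new highest
block. -/
theorem code_succ (q : ℕ) (a b c : ℕ → ℕ) (n i : ℕ) : code q a b c (n + 1) i =
    code q a b c n i + q ^ (3 * n) * (a (i + n) + q * (b (i + n) + q * c (i + n))) := by
  induction n generalizing i with
  | zero => simp [code]
  | succ n ih =>
    rw [code, ih, code, show i + 1 + n = i + (n + 1) by ring]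
    ring

/-- The store after `j` rounds. -/
def roundStore (r side i dout W s₁ s₂ s₃ : ℕ) (a b c d a' b' c' d' : ℕ → ZMod p) (j : ℕ) :
    List ℕ :=
  [r - j, side, code p (fun i => (a i).val) (fun i => (b i).val) (fun i => (c i).val) (r - j)
    (j + 1), i, p, W, W ^ (j + 1), pack W a j, pack W d j, pack W b j, pack W c j, (b j).val,
    (d j).val, (b' j).val, (d' j).val, s₁, s₂, s₃,
    code p (fun i => (a' i).val) (fun i => (b' i).val) (fun i => (c' i).val) j 1, p ^ (3 * j),
    p - 1, 1, dout, 0, 0, 0, 0, 0, 0, 0, 0, 0]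

theorem val_eq_mod {x : ZMod p} {n : ℕ} (h : x = n) : x.val = n - n / p * p := by
  rw [h, ZMod.val_natCast, sub_div_mul_self]

theorem nbrBody_run_roundStore {r side i dout W s₁ s₂ s₃ : ℕ} {a b c d a' b' c' d' : ℕ → ZMod p}
    (h : Transforms r s₁ s₂ s₃ a b c d a' b' c' d')
    (hW : (p * (r + 1)) * (p * (r + 1)) ≤ W) {j : ℕ} (hj : j < r) :
    Prog.nbrBody.run (roundStore r side i dout W s₁ s₂ s₃ a b c d a' b' c' d' j) =
      roundStore r side i dout W s₁ s₂ s₃ a b c d a' b' c' d' (j + 1) := by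
  have hp : 0 < p := NeZero.pos p
  obtain ⟨n, hn⟩ : ∃ n, r - j = n + 1 := ⟨r - j - 1, by omega⟩
  have hn' : r - (j + 1) = n := by omega
  have hdiv : ∀ (x : ZMod p) (y : ℕ), (x.val + p * y) / p = y := fun x y => by
    rw [Nat.add_mul_div_left _ _ hp, Nat.div_eq_of_lt (ZMod.val_lt x), zero_add]
  have hmod : ∀ (x : ZMod p) (y : ℕ),
      x.val = x.val + p * y - (x.val + p * y) / p * p := fun x y => by
    rw [sub_div_mul_self, Nat.add_mul_mod_self_left, Nat.mod_eq_of_lt (ZMod.val_lt x)]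
  set Z := code p (fun i => (a i).val) (fun i => (b i).val) (fun i => (c i).val) n (j + 1 + 1)
    with hZ
  rw [Prog.nbrBody_run, roundStore, hn, code, ← hZ]
  rw [Prog.readBlock_run (a := (a (j + 1)).val) (b := (b (j + 1)).val) (c := (c (j + 1)).val)
    (y₃ := Z) (hmod _ _) rfl (by rw [hdiv]; exact hmod _ _) rfl (by rw [hdiv, hdiv]; exact hmod _ _)
    (by rw [hdiv, hdiv, hdiv]) (pack_succ W a j) (pack_succ W b j) (pack_succ W c j)]
  have hp1 : ((p - 1 : ℕ) : ZMod p) = -1 := by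
    rw [Nat.cast_sub hp, ZMod.natCast_self]
    simp
  -- The packed `d` stops at index j, so the digit omits exactly the term a 0 * d (j + 1) = -d (j +
  -- 1), for which the determinant equation is solved.
  have hd : d (j + 1) = ((pack W a (j + 1) * pack W d j / W ^ (j + 1) % W +
      pack W b (j + 1) * pack W c (j + 1) / W ^ (j + 1) % W * (p - 1) : ℕ) : ZMod p) := by
    rw [Nat.cast_add, Nat.cast_mul, pack_mul_digit a d (by omega) (by omega) hW,
      pack_mul_digit b c (by omega) (by omega) hW, hp1]
    have h1 : ∑ x ∈ Finset.HasAntidiagonal.antidiagonal (j + 1), (if x.1 ≤ j + 1 then b x.1 else 0) *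
        (if x.2 ≤ j + 1 then c x.2 else 0) =
        ∑ x ∈ Finset.HasAntidiagonal.antidiagonal (j + 1), b x.1 * c x.2 := by
      refine Finset.sum_congr rfl fun x hx => ?_
      rw [Finset.HasAntidiagonal.mem_antidiagonal] at hx
      rw [if_pos (by omega), if_pos (by omega)]
    rw [h1, ← h.det j hj, sum_antidiagonal_succ, sum_antidiagonal_succ]
    have h2 : ∑ x ∈ Finset.HasAntidiagonal.antidiagonal j, (if x.1 + 1 ≤ j + 1 then a (x.1 + 1) else 0) *
        (if x.2 ≤ j then d x.2 else 0) =
        ∑ x ∈ Finset.HasAntidiagonal.antidiagonal j, a (x.1 + 1) * d x.2 := by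
      refine Finset.sum_congr rfl fun x hx => ?_
      rw [Finset.HasAntidiagonal.mem_antidiagonal] at hx
      rw [if_pos (by omega), if_pos (by omega)]
    rw [h2, if_neg (show ¬ (j + 1 ≤ j) by omega), h.a_zero]
    ring
  have ha₁ : a (j + 1) + s₁ * b j = (((b j).val * s₁ + (a (j + 1)).val : ℕ) : ZMod p) := by
    push_cast
    simp only [ZMod.natCast_zmod_val]
    ring
  have hc₁ : c (j + 1) + s₁ * d j = (((d j).val * s₁ + (c (j + 1)).val : ℕ) : ZMod p) := by
    push_cast
    simp only [ZMod.natCast_zmod_val]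
    ring
  rw [Prog.convBlock_run (d := (d (j + 1)).val) rfl rfl rfl rfl rfl
    (val_eq_mod (by rw [sub_div_mul_self, sub_div_mul_self]; exact hd)) (pack_succ W d j)]
  rw [Prog.matrixBlock_run (a₁ := (a (j + 1) + s₁ * b j).val) (c₁ := (c (j + 1) + s₁ * d j).val)
    (b' := (b' (j + 1)).val) (d' := (d' (j + 1)).val) (a' := (a' (j + 1)).val)
    (c' := (c' (j + 1)).val) rfl (val_eq_mod ha₁) rfl (val_eq_mod hc₁)
    rfl (val_eq_mod ?_) rfl (val_eq_mod ?_) rfl (val_eq_mod ?_) rfl (val_eq_mod ?_)]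
  rotate_left
  · rw [h.b' j hj]
    push_cast
    simp only [ZMod.natCast_zmod_val]
    ring
  · rw [h.d' j hj]
    push_cast
    simp only [ZMod.natCast_zmod_val]
    ring
  · rw [h.a' j hj]
    push_cast
    simp only [ZMod.natCast_zmod_val]
    ring
  · rw [h.c' j hj]
    push_cast
    simp only [ZMod.natCast_zmod_val]
    ring
  rw [Prog.writeBlock_run rfl rfl rfl, roundStore, hn', ← hZ, code_succ, Nat.add_sub_cancel,
    add_comm 1 j]
  simp only [List.cons.injEq, true_and, and_true]
  refine ⟨by ring, by ring, by ring⟩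

/-- Packed series are below W^(r+1), and codes are below p^(3r) ≤ W^(2r) because p² ≤ W. So W^(2r+1)
bounds all that grows. -/
theorem roundStore_le {r side i dout W s₁ s₂ s₃ V : ℕ} {a b c d a' b' c' d' : ℕ → ZMod p}
    (hpW : p * p ≤ W) (hr : r ≤ V) (hV : W ^ (2 * r + 1) ≤ V) (hside : side ≤ p) (hi : i ≤ p)
    (hdout : dout ≤ p) (h₁ : s₁ ≤ p) (h₂ : s₂ ≤ p) (h₃ : s₃ ≤ p) {j : ℕ} (hj : j ≤ r) :
    ∀ x ∈ roundStore r side i dout W s₁ s₂ s₃ a b c d a' b' c' d' j, x ≤ V := by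
  have hp : 0 < p := NeZero.pos p
  have hpW' : p ≤ W := (Nat.le_mul_self p).trans hpW
  have hW0 : 0 < W := by omega
  have hpow : ∀ e ≤ 2 * r + 1, W ^ e ≤ V := fun e he => (Nat.pow_le_pow_right hW0 he).trans hV
  have hWV : W ≤ V := by simpa using hpow 1 (by omega)
  have hpV : p ≤ V := hpW'.trans hWV
  have hval : ∀ x : ZMod p, x.val ≤ V := fun x => (ZMod.val_lt x).le.trans hpV
  have hpp : ∀ e ≤ r, p ^ (3 * e) ≤ V := fun e he => by
    calc p ^ (3 * e) ≤ p ^ (2 * (2 * e)) := Nat.pow_le_pow_right hp (by omega)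
      _ = (p * p) ^ (2 * e) := by rw [pow_mul, pow_two]
      _ ≤ W ^ (2 * e) := Nat.pow_le_pow_left hpW _
      _ ≤ V := hpow _ (by omega)
  have hcode : ∀ (f g h : ℕ → ZMod p) (e l : ℕ), e ≤ r →
      code p (fun i => (f i).val) (fun i => (g i).val) (fun i => (h i).val) e l ≤ V :=
    fun f g h e l he => (code_lt (fun _ => ZMod.val_lt _) (fun _ => ZMod.val_lt _)
      (fun _ => ZMod.val_lt _) e l).le.trans (hpp e he)
  have hpack : ∀ f : ℕ → ZMod p, pack W f j ≤ V := fun f =>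
    (pack_lt hpW' f j).le.trans (hpow _ (by omega))
  simp only [roundStore, List.forall_mem_cons]
  refine ⟨by omega, by omega, hcode _ _ _ _ _ (by omega), by omega, hpV, hWV, hpow _ (by omega),
    hpack _, hpack _, hpack _, hpack _, hval _, hval _, hval _, hval _, by omega, by omega,
    by omega, hcode _ _ _ _ _ hj, hpp _ hj, by omega, by omega, by omega, ?_⟩
  simp

end Rounds

end Ram

/-! ### Running times -/

namespace Ram

open LU

theorem ofList_append_replicate (l : List ℕ) (n : ℕ) :
    ofList (l ++ List.replicate n 0) = ofList l := by
  funext j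
  simp only [ofList, List.getD_eq_getElem?_getD, List.getElem?_append]
  split_ifs with h
  · rfl
  · rw [List.getElem?_eq_none (l := l) (by omega), List.getElem?_replicate]
    split_ifs <;> rfl

theorem len_le {x : ℕ} (hx : 0 < x) : len x ≤ x := Nat.log_lt_self 2 hx.ne'

/-- Bounding the length of c(m + 4)² by the number itself gives numbers of length O(m³), and there
are O(m) rounds. -/
theorem loop_time_le {K N c m : ℕ} (hN : N ≤ m + 2) (hc : 0 < c) :
    K * ((N + 1) * len ((c * (m + 4) ^ 2) ^ (4 * (m + 4)))) ≤ 5 * K * c * (m + 4) ^ 4 := by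
  have h1 := len_pow_le (c * (m + 4) ^ 2) (4 * (m + 4))
  have h2 := len_le (x := c * (m + 4) ^ 2) (by positivity)
  calc K * ((N + 1) * len ((c * (m + 4) ^ 2) ^ (4 * (m + 4))))
      ≤ K * ((m + 2 + 1) * ((4 * (m + 4) + 1) * (c * (m + 4) ^ 2))) := by
        gcongr
        exact h1.trans (Nat.mul_le_mul_left _ h2)
    _ = K * c * (m + 4) ^ 2 * ((m + 3) * (4 * m + 17)) := by ring
    _ ≤ K * c * (m + 4) ^ 2 * (5 * (m + 4) ^ 2) := by
        refine Nat.mul_le_mul_left _ ?_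
        nlinarith
    _ = _ := by ring

/-- The size program is correct and runs in polynomial time. -/
theorem exists_size_computesIn {p d₁ d₂ : ℕ} (hp : 2 ≤ p) (h₁ : d₁ ≤ p) (h₂ : d₂ ≤ p) :
    ∃ C : ℕ, ∀ m,
      (Prog.size p d₁ d₂).ComputesIn [m, 0] (d₂ * p ^ (3 * (m + 1) + 2)) (C * (m + 4) ^ 4) ∧
      (Prog.size p d₁ d₂).ComputesIn [m, 1] (d₁ * p ^ (3 * (m + 1) + 2)) (C * (m + 4) ^ 4) := by
  obtain ⟨V₀, K, h⟩ := exists_computesIn (n := 5) (a := 0)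
    (P := Prog.block [.const 2 (p ^ 3), .const 4 1,
      .ite 1 (.const 3 (d₁ * p ^ 5)) (.const 3 (d₂ * p ^ 5))])
    (Q := Prog.block [.mul 3 3 2, .sub 0 0 4]) (R := Prog.add 0 3 0)
    (by simp [Prog.block, Prog.IsSimple]) (by simp [Prog.block, Prog.IsSimple])
    (by simp [Prog.IsSimple])
  set c := V₀ + p with hc
  have hc0 : 0 < c := by omega
  refine ⟨5 * K * c, fun m => ?_⟩
  set V := (c * (m + 4) ^ 2) ^ (4 * (m + 4)) with hV
  have hbase : c + m ≤ c * (m + 4) ^ 2 := by nlinarith [Nat.zero_le (c * m), Nat.zero_le (c * m ^ 2)]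
  have hb0 : 0 < c * (m + 4) ^ 2 := by positivity
  have hpow : ∀ e ≤ 4 * (m + 4), p ^ e ≤ V := fun e he =>
    (Nat.pow_le_pow_left (show p ≤ c * (m + 4) ^ 2 by omega) e).trans (Nat.pow_le_pow_right hb0 he)
  have hbV : c * (m + 4) ^ 2 ≤ V := Nat.le_self_pow (by omega) _
  have key : ∀ side d, side ≤ 1 → d ≤ p →
      (Prog.block [.const 2 (p ^ 3), .const 4 1,
        .ite 1 (.const 3 (d₁ * p ^ 5)) (.const 3 (d₂ * p ^ 5))]).run [m, side, 0, 0, 0] =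
        [m, side, p ^ 3, d * p ^ 5, 1] →
      (Prog.size p d₁ d₂).ComputesIn [m, side] (d * p ^ (3 * (m + 1) + 2))
        (5 * K * c * (m + 4) ^ 4) := by
    intro side d hside hd hrun
    have := h V (by omega) m [m, side] [m, side, 0, 0, 0]
      (fun j => [m - j, side, p ^ 3, d * (p ^ 5 * p ^ (3 * j)), 1])
      (ofList_append_replicate [m, side] 3).symm rfl ?_ (by simpa using hrun) (fun _ _ => rfl) ?_
      ?_ ?_ (by simp)
    · obtain ⟨τ, s, h1, h2, h3⟩ := this
      refine ⟨τ, s, h1, h2.trans (loop_time_le (by omega) hc0), h3.trans ?_⟩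
      simp only [Prog.run, Nat.sub_self, List.set_cons_zero, List.getD_cons_zero,
        List.getD_cons_succ, add_zero]
      rw [← pow_add]
      congr 2
      ring
    · simp only [List.forall_mem_cons]
      refine ⟨by omega, by omega, by omega, by omega, by omega, by simp⟩
    · intro j hj
      simp only [List.forall_mem_cons]
      refine ⟨by omega, by omega, hpow 3 (by omega), ?_, by omega, by simp⟩
      calc d * (p ^ 5 * p ^ (3 * j)) ≤ p * (p ^ 5 * p ^ (3 * j)) := Nat.mul_le_mul_right _ hd
        _ = p ^ (3 * j + 6) := by ring
        _ ≤ V := hpow _ (by omega)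
    · intro j hj
      simp only [Prog.block, Prog.run, List.set_cons_zero, List.getD_cons_zero,
        List.getD_cons_succ, List.set_cons_succ, List.cons.injEq, true_and, and_true]
      exact ⟨by omega, by ring⟩
    · intro j hj
      simp only [List.getD_cons_zero]
      omega
  exact ⟨key 0 d₂ (by omega) h₂ rfl, key 1 d₁ le_rfl h₁ rfl⟩

/-- The program `nbr` turns the coefficients of one vertex into the code of an adjacent vertex,
within time `C * (m + 4) ^ 4`. -/
def NbrRunsWithin (p : ℕ) [Fact p.Prime] (d₁ d₂ C : ℕ) : Prop :=
  ∀ (m side v i dout s₁ s₂ s₃ : ℕ) (a b c d a' b' c' d' : ℕ → ZMod p),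
    Transforms (m + 2) s₁ s₂ s₃ a b c d a' b' c' d' → side ≤ 1 → v ≤ p ^ (3 * m + 6) → i ≤ p →
    dout ≤ p → s₁ ≤ p → s₂ ≤ p → s₃ ≤ p →
    (Prog.nbrInit p d₁ d₂).run ([m, side, v, i] ++ List.replicate 28 0) =
      roundStore (m + 2) side i dout ((4 + m) * p * ((4 + m) * p)) s₁ s₂ s₃
        a b c d a' b' c' d' 0 →
    (Prog.nbr p d₁ d₂).ComputesIn [m, side, v, i]
      (i + dout * squeeze p (code p (fun i => (a' i).val) (fun i => (b' i).val)
        (fun i => (c' i).val) (m + 2) 1)) (C * (m + 4) ^ 4)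

theorem exists_nbrRunsWithin (p : ℕ) [Fact p.Prime] (d₁ d₂ : ℕ) : ∃ C, NbrRunsWithin p d₁ d₂ C := by
  obtain ⟨V₀, K, h⟩ := exists_computesIn (n := 32) (a := 0) (Prog.isSimple_nbrInit p d₁ d₂)
    Prog.isSimple_nbrBody Prog.isSimple_nbrFinal
  have hp : 0 < p := NeZero.pos p
  -- The summand V₀ puts V above the threshold, and p² gives W ≤ c₀(m + 4)².
  set c₀ := V₀ + p * p with hc
  have hpp : 0 < p * p := Nat.mul_pos hp hp
  have hp2 : 2 * 2 ≤ p * p :=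
    Nat.mul_le_mul (Fact.out : p.Prime).two_le (Fact.out : p.Prime).two_le
  have hc0 : 0 < c₀ := by omega
  refine ⟨5 * K * c₀, ?_⟩
  intro m side v i dout s₁ s₂ s₃ a b c d a' b' c' d' hT hside hv hi hdout h₁ h₂ h₃ hinit
  set V := (c₀ * (m + 4) ^ 2) ^ (4 * (m + 4)) with hV
  set W := (4 + m) * p * ((4 + m) * p) with hW
  have hbase : c₀ + m ≤ c₀ * (m + 4) ^ 2 := by
    nlinarith [Nat.zero_le (c₀ * m), Nat.zero_le (c₀ * m ^ 2)]
  have hb0 : 0 < c₀ * (m + 4) ^ 2 := by positivity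
  have hbV : c₀ * (m + 4) ^ 2 ≤ V := Nat.le_self_pow (by omega) _
  have hpc : p ≤ c₀ := (Nat.le_mul_self p).trans (by omega)
  have hpW : p * p ≤ W := by
    rw [hW]
    exact Nat.mul_le_mul (Nat.le_mul_of_pos_left _ (by omega)) (Nat.le_mul_of_pos_left _ (by omega))
  have hWle : W ≤ c₀ * (m + 4) ^ 2 := by
    calc W = p * p * (m + 4) ^ 2 := by rw [hW]; ring
      _ ≤ _ := Nat.mul_le_mul_right _ (by omega)
  have hWV : W ^ (2 * (m + 2) + 1) ≤ V :=
    (Nat.pow_le_pow_left hWle _).trans (Nat.pow_le_pow_right hb0 (by omega))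
  have hvV : v ≤ V := hv.trans ((Nat.pow_le_pow_left (show p ≤ c₀ * (m + 4) ^ 2 by omega) _).trans
    (Nat.pow_le_pow_right hb0 (by omega)))
  have := h V (by omega) (m + 2) [m, side, v, i] ([m, side, v, i] ++ List.replicate 28 0)
    (roundStore (m + 2) side i dout W s₁ s₂ s₃ a b c d a' b' c' d')
    (ofList_append_replicate _ 28).symm rfl ?_ hinit (fun _ _ => rfl)
    (fun j hj => roundStore_le hpW (by omega) hWV (by omega) hi hdout h₁ h₂ h₃ hj)
    (fun j hj => nbrBody_run_roundStore hT (by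
      rw [hW, mul_comm p]
      exact Nat.mul_le_mul (Nat.mul_le_mul_right _ (by omega)) (Nat.mul_le_mul_right _ (by omega)))
      hj) ?_ ?_
  · obtain ⟨τ, s, e1, e2, e3⟩ := this
    refine ⟨τ, s, e1, e2.trans (loop_time_le le_rfl hc0), e3.trans ?_⟩
    rw [roundStore, Prog.nbrFinal_run, sub_div_mul_self, squeeze, Nat.div_div_eq_div_mul,
      show p * p = p ^ 2 by ring, show p ^ 2 * p = p ^ 3 by ring]
    ring
  · intro x hx
    rcases List.mem_append.1 hx with hx | hx
    · have hall : ∀ x ∈ [m, side, v, i], x ≤ V := by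
        simp only [List.forall_mem_cons]
        exact ⟨by omega, by omega, by omega, by omega, by simp⟩
      exact hall x hx
    · rw [List.eq_of_mem_replicate hx]
      exact Nat.zero_le _
  · intro j hj
    simp only [roundStore, List.getD_cons_zero]
    omega
  · simp [roundStore]

end Ram

/-! ## The graphs are strongly explicit -/

namespace LU

open PowerSeries Ram

section Neighbours

variable {p : ℕ} [Fact p.Prime] {k r d d₁ d₂ : ℕ}

/-- The last lower factor adds s₃X times the finished second column to the first, so the first
column of the result involves b' and d' at the previous index only. This makes a computation by
rounds possible. -/
theorem transforms_of_redMat_eq {u w : Fin k → ZMod p} {x y x' y' : ZMod p} {s₁ s₂ s₃ : ℕ}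
    (hdet : toTrunc (ZMod p) r (genMat u x y).det = -1)
    (h : redMat (ZMod p) r (genMat w x' y') = redMat (ZMod p) r
      (genMat u x y * lower (s₁ : ZMod p) * upper (s₂ : ZMod p) * lower (s₃ : ZMod p))) :
    Transforms r s₁ s₂ s₃ (diag u) (up u x) (down u y) (diag' u) (diag w) (up w x') (down w y')
      (diag' w) := by
  rw [redMat_eq_iff] at h
  simp only [genMat, lower, upper, Matrix.mul_fin_two, Fin.forall_fin_two, Matrix.of_apply,
    Matrix.cons_val_zero, Matrix.cons_val_one, Matrix.cons_val', Matrix.cons_val_fin_one,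
    mul_one, mul_zero, zero_add, add_zero] at h
  obtain ⟨⟨h1, h2⟩, h3, h4⟩ := h
  refine ⟨rfl, rfl, rfl, rfl, fun j hj => ?_, fun j hj => ?_, fun j hj => ?_, fun j hj => ?_,
    fun j hj => ?_⟩
  · rw [show (-1 : Trunc (ZMod p) r) = toTrunc (ZMod p) r (-1) by simp, toTrunc_eq_iff] at hdet
    have := hdet (j + 1) hj
    rw [map_neg, coeff_one, if_neg (by omega), neg_zero, Matrix.det_fin_two, map_sub, coeff_mul,
      coeff_mul, sub_eq_zero] at this
    simpa [genMat] using this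
  · have e1 := h1 (j + 1) hj
    have e2 := h2 j hj.le
    rw [map_add, coeff_succ_mul_C_X _ _ j, ← e2, map_add, coeff_succ_mul_C_X] at e1
    simp only [coeff_mk] at e1
    linear_combination e1
  · have e2 := h2 (j + 1) hj
    rw [map_add, coeff_mul_C, map_add, coeff_succ_mul_C_X] at e2
    simp only [coeff_mk] at e2
    linear_combination e2
  · have e1 := h3 (j + 1) hj
    have e2 := h4 j hj.le
    rw [map_add, coeff_succ_mul_C_X _ _ j, ← e2, map_add, coeff_succ_mul_C_X] at e1
    simp only [coeff_mk] at e1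
    linear_combination e1
  · have e2 := h4 (j + 1) hj
    rw [map_add, coeff_mul_C, map_add, coeff_succ_mul_C_X] at e2
    simp only [coeff_mk] at e2
    linear_combination e2

theorem code_zero (q : ℕ) (a b c : ℕ → ℕ) (i : ℕ) : code q a b c 0 i = 0 := rfl

theorem diag_zero (u : Fin k → ZMod p) : diag u 0 = -1 := rfl

theorem diag'_zero (u : Fin k → ZMod p) : diag' u 0 = 1 := rfl

theorem up_zero (u : Fin k → ZMod p) (x : ZMod p) : up u x 0 = x := rfl

theorem down_zero (u : Fin k → ZMod p) (y : ZMod p) : down u y 0 = 0 := rfl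

theorem code_up (u : Fin k → ZMod p) (x : ZMod p) (a c : ℕ → ℕ) (n i : ℕ) :
    code p a (fun i => (up u x i).val) c n (i + 1) =
      code p a (fun i => (up u 0 i).val) c n (i + 1) := by
  induction n generalizing i with
  | zero => rfl
  | succ n ih =>
    rw [code, code, ih (i + 1)]
    simp [up]

theorem val_neg_one : (-1 : ZMod p).val = p - 1 := by
  rw [ZMod.neg_val, if_neg one_ne_zero, ZMod.val_one]

theorem number_mod (hd : d < p) {u : Fin k → ZMod p} (hu : entry u 0 ∈ colors p d) (y : ZMod p) :
    (entry u 0).val = number d r u y - number d r u y / d * d + 1 := by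
  rw [mem_colors hd] at hu
  rw [number, sub_div_mul_self, Nat.add_mul_mod_self_left, Nat.mod_eq_of_lt (by omega)]
  omega

theorem number_div (hd : d < p) {u : Fin k → ZMod p} (hu : entry u 0 ∈ colors p d) (y : ZMod p) :
    squeeze p (vectorCode r u y) = number d r u y / d := by
  rw [mem_colors hd] at hu
  rw [number, Nat.add_mul_div_left _ _ (by omega), Nat.div_eq_of_lt (by omega), zero_add]

theorem vectorCode_eq (u : Fin k → ZMod p) (y : ZMod p) :
    vectorCode (r + 1) u y = squeeze p (vectorCode (r + 1) u y) -
      squeeze p (vectorCode (r + 1) u y) / (p * p) * (p * p) +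
      (squeeze p (vectorCode (r + 1) u y) / (p * p) * p + y.val) * (p * p) := by
  have := unsqueeze_squeeze (NeZero.pos p) (vectorCode (r + 1) u y)
  rw [vectorCode_div_mod] at this
  conv_lhs => rw [← this]
  rw [unsqueeze, sub_div_mul_self, pow_two]
  ring

/-- The program computes the lines through a point. -/
theorem nbr_computesIn_line {m C i : ℕ} (hk : k + 1 = 4 * (m + 2))
    (hC : NbrRunsWithin p d₁ d₂ C) (hd₁ : d₁ < p) (hd₂ : d₂ < p) {u l : Fin k → ZMod p} (hu : PointCertificateZero u)
    (hu0 : entry u 0 ∈ colors p d₂) (h : Incident u l) (hi : i < d₁)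
    (hl : entry l 0 = ((i + 1 : ℕ) : ZMod p)) :
    (Prog.nbr p d₁ d₂).ComputesIn [m, 0, number d₂ (m + 2) u 0, i]
      (number d₁ (m + 2) l (entry l 0)) (C * (m + 4) ^ 4) := by
  have hlv : (entry l 0).val = i + 1 := by
    rw [hl, ZMod.val_natCast, Nat.mod_eq_of_lt (by omega)]
  have hT := transforms_of_redMat_eq (s₁ := i + 1) (s₂ := (entry u 0).val) (s₃ := 0)
    ((pointCertificateZero_iff hk u).1 hu) (by
      rw [← hl, ZMod.natCast_zmod_val, Nat.cast_zero, lower_zero, Matrix.mul_one]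
      exact (incident_iff_line hk u l).1 h)
  have := hC m 0 (number d₂ (m + 2) u 0) i d₁ _ _ _ _ _ _ _ _ _ _ _ hT (by omega) ?_ (by omega)
    hd₁.le (by omega) (ZMod.val_lt _).le (Nat.zero_le _) ?_
  · have hnum : number d₁ (m + 2) l (entry l 0) =
        i + d₁ * squeeze p (vectorCode (m + 2) l (entry l 0)) := by
      rw [number, hlv, Nat.add_sub_cancel]
    rw [hnum]
    exact this
  · refine (number_lt hd₂ hu0 (m + 1) 0).le.trans ?_
    calc d₂ * p ^ (3 * (m + 1) + 2) ≤ p * p ^ (3 * (m + 1) + 2) := Nat.mul_le_mul_right _ hd₂.le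
      _ = _ := by ring
  · have hO := vectorCode_eq (r := m + 1) u 0
    rw [ZMod.val_zero, add_zero] at hO
    rw [Prog.nbrInit_run_zero (number_mod hd₂ hu0 0) (number_div hd₂ hu0 0) hO rfl]
    rw [roundStore, code_up]
    simp [pack, code_zero, diag_zero, diag'_zero, up_zero, down_zero, val_neg_one, ZMod.val_one,
      vectorCode]

/-- The program computes the points on a line. -/
theorem nbr_computesIn_point {m C i : ℕ} (hk : k + 1 = 4 * (m + 2))
    (hC : NbrRunsWithin p d₁ d₂ C) (hd₁ : d₁ < p) (hd₂ : d₂ < p) {u l : Fin k → ZMod p} (hl : LineCertificateZero l)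
    (hl0 : entry l 0 ∈ colors p d₁) (h : Incident u l) (hi : i < d₂)
    (hu : entry u 0 = ((i + 1 : ℕ) : ZMod p)) :
    (Prog.nbr p d₁ d₂).ComputesIn [m, 1, number d₁ (m + 2) l (entry l 0), i]
      (number d₂ (m + 2) u 0) (C * (m + 4) ^ 4) := by
  have huv : (entry u 0).val = i + 1 := by
    rw [hu, ZMod.val_natCast, Nat.mod_eq_of_lt (by omega)]
  -- The machine has no negative numbers; p - n represents -n.
  have hT := transforms_of_redMat_eq (s₁ := 0) (s₂ := p - (i + 1)) (s₃ := p - (entry l 0).val)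
    ((lineCertificateZero_iff hk l).1 hl) (by
      rw [Nat.cast_zero, lower_zero, Matrix.mul_one, Nat.cast_sub (by omega), ← hu,
        Nat.cast_sub (ZMod.val_lt _).le, ZMod.natCast_zmod_val, ZMod.natCast_self, zero_sub,
        zero_sub]
      exact (incident_iff_point hk u l).1 h)
  have := hC m 1 (number d₁ (m + 2) l (entry l 0)) i d₂ _ _ _ _ _ _ _ _ _ _ _ hT (by omega) ?_
    (by omega) hd₂.le (by omega) (by omega) (by omega) ?_
  · have hnum : number d₂ (m + 2) u 0 = i + d₂ * squeeze p (vectorCode (m + 2) u 0) := by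
      rw [number, huv, Nat.add_sub_cancel]
    rw [hnum, vectorCode, ← code_up u (entry u 0)]
    exact this
  · refine (number_lt hd₁ hl0 (m + 1) _).le.trans ?_
    calc d₁ * p ^ (3 * (m + 1) + 2) ≤ p * p ^ (3 * (m + 1) + 2) := Nat.mul_le_mul_right _ hd₁.le
      _ = _ := by ring
  · have hO := vectorCode_eq (r := m + 1) l (entry l 0)
    rw [Prog.nbrInit_run_one (number_mod hd₁ hl0 _) (number_div hd₁ hl0 _) hO rfl]
    rw [roundStore]
    simp [pack, code_zero, diag_zero, diag'_zero, up_zero, down_zero, val_neg_one, ZMod.val_one,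
      vectorCode, huv]

/-- The residues `1, …, d` in their natural order. -/
noncomputable def colorsEquiv (hd : d < p) : Fin d ≃ colors p d :=
  Equiv.ofBijective (fun i => ⟨((i + 1 : ℕ) : ZMod p), Finset.mem_image_of_mem _
    (Finset.mem_range.2 i.2)⟩) (by
    rw [Fintype.bijective_iff_injective_and_card]
    refine ⟨fun i j h => ?_, by simp [card_colors hd]⟩
    have := congrArg ZMod.val (Subtype.ext_iff.1 h)
    rw [ZMod.val_natCast, ZMod.val_natCast, Nat.mod_eq_of_lt (by omega),
      Nat.mod_eq_of_lt (by omega)] at this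
    exact Fin.ext (by omega))

theorem card_left (hk : k + 1 = 4 * (r + 1)) (hd : d₂ < p) (B : Finset (ZMod p)) :
    Nat.card (CD k (colors p d₂) B).Left = d₂ * p ^ (3 * r + 2) :=
  (Nat.card_congr (pointNumbering hk hd B)).trans (Nat.card_fin _)

theorem card_right (hk : k + 1 = 4 * (r + 1)) (hd : d₁ < p) (A : Finset (ZMod p)) :
    Nat.card (CD k A (colors p d₁)).Right = d₁ * p ^ (3 * r + 2) :=
  (Nat.card_congr (lineNumbering hk hd A)).trans (Nat.card_fin _)

theorem ComputesIn.mono {P : Prog} {input : List ℕ} {out s t : ℕ} (h : P.ComputesIn input out s)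
    (hst : s ≤ t) : P.ComputesIn input out t := by
  obtain ⟨τ, s', h1, h2, h3⟩ := h
  exact ⟨τ, s', h1, h2.trans hst, h3⟩

/-- The order is at least 2^m, so m is at most its logarithm and time polynomial in m suffices. -/
theorem stronglyExplicit_CD (h₁ : d₁ < p) (h₂ : d₂ < p) (hd : 0 < d₂) :
    StronglyExplicit fun m => CD (4 * m + 7) (colors p d₂) (colors p d₁) := by
  have hk : ∀ m, 4 * m + 7 + 1 = 4 * (m + 1 + 1) := fun m => by ring
  have hp2 := (Fact.out : p.Prime).two_le
  obtain ⟨C, hC⟩ := exists_nbrRunsWithin p d₁ d₂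
  obtain ⟨C', hC'⟩ := exists_size_computesIn hp2 h₁.le h₂.le
  refine ⟨Prog.nbr p d₁ d₂, Prog.size p d₁ d₂,
    Polynomial.C (C + C') * (Polynomial.X + Polynomial.C 4) ^ 4,
    fun m => (pointNumbering (hk m) h₂ _).trans (finCongr (card_left (hk m) h₂ _).symm),
    fun m => (lineNumbering (hk m) h₁ _).trans (finCongr (card_right (hk m) h₁ _).symm), ?_⟩
  intro m
  have hm : m ≤ Nat.log 2 (CD (4 * m + 7) (colors p d₂) (colors p d₁)).order := by
    refine Nat.le_log_of_pow_le (by norm_num) ?_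
    rw [BipartiteGraph.order, card_left (hk m) h₂]
    calc 2 ^ m ≤ p ^ m := Nat.pow_le_pow_left hp2 m
      _ ≤ p ^ (3 * (m + 1) + 2) := Nat.pow_le_pow_right (by omega) (by omega)
      _ ≤ d₂ * p ^ (3 * (m + 1) + 2) := Nat.le_mul_of_pos_left _ hd
      _ ≤ _ := Nat.le_add_right _ _
  set t := Nat.log 2 (CD (4 * m + 7) (colors p d₂) (colors p d₁)).order with ht
  have hT : ∀ c ≤ C + C', c * (m + 4) ^ 4 ≤
      (Polynomial.C (C + C') * (Polynomial.X + Polynomial.C 4) ^ 4).eval t := by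
    intro c hc
    simp only [Polynomial.eval_mul, Polynomial.eval_C, Polynomial.eval_pow, Polynomial.eval_add,
      Polynomial.eval_X]
    exact Nat.mul_le_mul hc (Nat.pow_le_pow_left (by omega) 4)
  have hbi := isBiregular_CD (hk m) (colors p d₂) (colors p d₁)
  rw [card_colors h₁, card_colors h₂] at hbi
  refine ⟨?_, ?_, ?_, ?_⟩
  · intro v
    refine ⟨(finCongr (hbi.1 v)).trans ((colorsEquiv h₁).trans
      (lineNeighbors (hk m) (colors p d₂) (colors p d₁) v).symm), fun i => ?_⟩
    set w := (lineNeighbors (hk m) (colors p d₂) (colors p d₁) v).symm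
      (colorsEquiv h₁ (finCongr (hbi.1 v) i)) with hw
    have hw0 : entry w.1.1 0 = ((i + 1 : ℕ) : ZMod p) := by
      have := (Equiv.symm_apply_eq _).1 hw.symm
      exact (congrArg Subtype.val this).symm
    exact ComputesIn.mono (nbr_computesIn_line (hk m) hC h₁ h₂ v.2.1 v.2.2 w.2
      (i.2.trans_eq (hbi.1 v)) hw0) (hT C (by omega))
  · intro v
    refine ⟨(finCongr (hbi.2 v)).trans ((colorsEquiv h₂).trans
      (pointNeighbors (hk m) (colors p d₂) (colors p d₁) v).symm), fun i => ?_⟩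
    set w := (pointNeighbors (hk m) (colors p d₂) (colors p d₁) v).symm
      (colorsEquiv h₂ (finCongr (hbi.2 v) i)) with hw
    have hw0 : entry w.1.1 0 = ((i + 1 : ℕ) : ZMod p) := by
      have := (Equiv.symm_apply_eq _).1 hw.symm
      exact (congrArg Subtype.val this).symm
    exact ComputesIn.mono (nbr_computesIn_point (hk m) hC h₁ h₂ v.2.1 v.2.2 w.2
      (i.2.trans_eq (hbi.2 v)) hw0) (hT C (by omega))
  · rw [card_left (hk m) h₂]
    exact ComputesIn.mono (hC' m).1 (hT C' (by omega))
  · rw [card_right (hk m) h₁]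
    exact ComputesIn.mono (hC' m).2 (hT C' (by omega))

end Neighbours

end LU

/-! ## Choice of the parameters -/

namespace LU

open Filter

/-- The left side is n · n^(-3ε) = o(n), the right side is linear with positive slope. It is used
with n = p = d₂ + 1; the two further subtractions of 1 pay for the floors in d₁ = ⌊β₁d₂⌋ and D =
⌊ε₁d⌋. -/
theorem eventually_rpow_le {ε₁ β ε : ℝ} (hε₁ : 0 < ε₁) (hβ : 0 < β) (hε : 0 < ε) :
    ∀ᶠ n : ℕ in atTop, (n : ℝ) ^ (1 - 3 * ε) ≤ ε₁ * (β * (n - 1) - 1) - 1 := by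
  have h1 : Tendsto (fun n : ℕ => (n : ℝ) ^ (-(3 * ε))) atTop (nhds 0) :=
    (tendsto_rpow_neg_atTop (by positivity)).comp tendsto_natCast_atTop_atTop
  have h2 : ∀ᶠ n : ℕ in atTop, (n : ℝ) ^ (-(3 * ε)) < ε₁ * β / 2 :=
    h1.eventually_lt_const (by positivity)
  have h3 : ∀ᶠ n : ℕ in atTop, (ε₁ * β + ε₁ + 1) / (ε₁ * β / 2) ≤ (n : ℝ) :=
    tendsto_natCast_atTop_atTop.eventually_ge_atTop _
  filter_upwards [h2, h3, eventually_gt_atTop 0] with n h2 h3 hn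
  have hn' : (0 : ℝ) < n := by exact_mod_cast hn
  rw [div_le_iff₀ (by positivity)] at h3
  calc (n : ℝ) ^ (1 - 3 * ε) = n * (n : ℝ) ^ (-(3 * ε)) := by
        rw [sub_eq_add_neg, Real.rpow_add hn', Real.rpow_one]
    _ ≤ n * (ε₁ * β / 2) := by gcongr
    _ ≤ _ := by linarith

/-- With θ = p^(1-3ε), a side has at most p^(3(m+2)) vertices, whose power 1/3 - ε is θ^(m+2). The
factor θ⁻¹ lowers this to θ^(m+1) ≤ D^(m+1), and 1/2 makes the inequality strict. -/
theorem rpow_card_lt {p d m D : ℕ} {ε ε' : ℝ} (hd : 0 < d) (hdp : d ≤ p) (hε : ε ≤ ε')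
    (hε3 : ε ≤ 1 / 3) (hD : (p : ℝ) ^ (1 - 3 * ε) ≤ D) :
    ((p : ℝ) ^ (1 - 3 * ε))⁻¹ / 2 * ((d * p ^ (3 * (m + 1) + 2) : ℕ) : ℝ) ^ (1 / 3 - ε') <
      (D : ℝ) ^ (m + 1) := by
  have hp : 0 < p := by omega
  have hp' : (0 : ℝ) < p := by exact_mod_cast hp
  set θ := (p : ℝ) ^ (1 - 3 * ε) with hθ
  have hθ0 : 0 < θ := Real.rpow_pos_of_pos hp' _
  have hn1 : (1 : ℝ) ≤ ((d * p ^ (3 * (m + 1) + 2) : ℕ) : ℝ) := by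
    exact_mod_cast (show 0 < d * p ^ (3 * (m + 1) + 2) by positivity)
  have hn2 : ((d * p ^ (3 * (m + 1) + 2) : ℕ) : ℝ) ≤ ((p ^ (3 * (m + 2)) : ℕ) : ℝ) := by
    have : d * p ^ (3 * (m + 1) + 2) ≤ p ^ (3 * (m + 2)) := by
      calc d * p ^ (3 * (m + 1) + 2) ≤ p * p ^ (3 * (m + 1) + 2) := Nat.mul_le_mul_right _ hdp
        _ = _ := by ring
    exact_mod_cast this
  have h1 : ((d * p ^ (3 * (m + 1) + 2) : ℕ) : ℝ) ^ (1 / 3 - ε') ≤ θ ^ (m + 2) := by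
    calc ((d * p ^ (3 * (m + 1) + 2) : ℕ) : ℝ) ^ (1 / 3 - ε')
        ≤ ((d * p ^ (3 * (m + 1) + 2) : ℕ) : ℝ) ^ (1 / 3 - ε) :=
          Real.rpow_le_rpow_of_exponent_le hn1 (by linarith)
      _ ≤ ((p ^ (3 * (m + 2)) : ℕ) : ℝ) ^ (1 / 3 - ε) :=
          Real.rpow_le_rpow (by linarith) hn2 (by linarith)
      _ = θ ^ (m + 2) := by
          rw [hθ, ← Real.rpow_natCast, ← Real.rpow_mul hp'.le, Nat.cast_pow, ← Real.rpow_natCast,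
            ← Real.rpow_mul hp'.le]
          congr 1
          push_cast
          ring
  calc θ⁻¹ / 2 * ((d * p ^ (3 * (m + 1) + 2) : ℕ) : ℝ) ^ (1 / 3 - ε') ≤ θ⁻¹ / 2 * θ ^ (m + 2) := by
        gcongr
    _ = θ ^ (m + 1) / 2 := by
        field_simp
        ring
    _ < θ ^ (m + 1) := half_lt_self (by positivity)
    _ ≤ _ := pow_le_pow_left₀ hθ0.le hD _

end LU

/-! ### The main theorem -/

theorem mainTheorem3 (β₀ β₁ ε₁ ε₂ : ℝ) (hβ₀ : 0 ≤ β₀) (hβ : β₀ < β₁) (hβ₁ : β₁ ≤ 1)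
    (hε₁ : ε₁ ∈ Set.Ioc (0 : ℝ) 1) (hε₂ : ε₂ ∈ Set.Ioc (0 : ℝ) 1) :
    {d : ℕ × ℕ | 1 ≤ d.1 ∧ d.1 ≤ d.2 ∧ (d.1 : ℝ) / (d.2 : ℝ) ∈ Set.Icc β₀ β₁ ∧
      ∃ δ : ℝ, 0 < δ ∧
      ∃ (F : Type) (_ : Field F) (_ : Finite F) (A B : Finset F) (k : ℕ → ℕ),
        (0 : F) ∉ A ∧ (0 : F) ∉ B ∧ B.card = d.1 ∧ A.card = d.2 ∧
        (∀ m, 6 ≤ k m ∧ Odd (k m)) ∧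
        StrictMono (fun m => (LU.CD (k m) A B).order) ∧
        StronglyExplicit (fun m => LU.CD (k m) A B) ∧
        ∀ m,
          (LU.CD (k m) A B).IsBiregular d.1 d.2 ∧
          (LU.CD (k m) A B).LeftExpands
            (δ * (Nat.card (LU.CD (k m) A B).Left : ℝ) ^ (1 / 3 - ε₂)) ((1 - ε₁) * d.1) ∧
          (LU.CD (k m) A B).swap.LeftExpands
            (δ * (Nat.card (LU.CD (k m) A B).Right : ℝ) ^ (1 / 3 - ε₂))
            ((1 - ε₁) * d.2)}.Infinite := by
  refine Set.Infinite.of_image Prod.snd (Set.infinite_of_forall_exists_gt fun n => ?_)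
  have hβ₁0 : 0 < β₁ := hβ₀.trans_lt hβ
  -- For ε₂ > 1/3 the exponent 1/3 - ε₂ is negative; the minimum keeps 1/3 - ε nonnegative for the
  -- comparison of powers.
  set ε := min ε₂ (1 / 3) with hε
  have hε0 : 0 < ε := lt_min hε₂.1 (by norm_num)
  obtain ⟨N, hN⟩ := Filter.eventually_atTop.1 (LU.eventually_rpow_le hε₁.1 hβ₁0 hε0)
  -- The summands serve `eventually_rpow_le`, d₂ > n, and (β₁ - β₀)d₂ ≥ 1.
  obtain ⟨p, hpN, hp⟩ := Nat.exists_infinite_primes (N + n + 2 + ⌈(β₁ - β₀)⁻¹⌉₊)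
  have : Fact p.Prime := ⟨hp⟩
  have hp0 : (0 : ℝ) < p := by exact_mod_cast hp.pos
  have hrpow := hN p (by omega)
  have hθ : (0 : ℝ) < (p : ℝ) ^ (1 - 3 * ε) := Real.rpow_pos_of_pos hp0 _
  -- All nonzero residues are point colours, so d₂ = p - 1 and the degree is as large as possible
  -- compared with p.
  obtain ⟨d₂, rfl⟩ : ∃ d, p = d + 1 := ⟨p - 1, by have := hp.pos; omega⟩
  rw [Nat.cast_add, Nat.cast_one, add_sub_cancel_right] at hrpow
  have hd₂ : 0 < d₂ := by omega
  have hd₂' : (0 : ℝ) < d₂ := by exact_mod_cast hd₂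
  have hβd : 0 ≤ β₁ * d₂ := by positivity
  set d₁ := ⌊β₁ * d₂⌋₊ with hd₁
  have h1 : (d₁ : ℝ) ≤ β₁ * d₂ := Nat.floor_le hβd
  have h2 : β₁ * d₂ < d₁ + 1 := Nat.lt_floor_add_one _
  have h12 : d₁ ≤ d₂ := by
    have : (d₁ : ℝ) ≤ d₂ := h1.trans (mul_le_of_le_one_left hd₂'.le hβ₁)
    exact_mod_cast this
  -- Rounding β₁d₂ down loses less than 1, so d₁ stays at least β₀d₂.
  have hgap : 1 ≤ (β₁ - β₀) * d₂ := by
    have h3 : ((β₁ - β₀)⁻¹ : ℝ) ≤ d₂ := by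
      refine (Nat.le_ceil _).trans ?_
      exact_mod_cast (show ⌈(β₁ - β₀)⁻¹⌉₊ ≤ d₂ by omega)
    rwa [inv_le_iff_one_le_mul₀' (sub_pos.2 hβ)] at h3
  have hfloor : ∀ d : ℕ, d₁ ≤ d →
      ((d₂ + 1 : ℕ) : ℝ) ^ (1 - 3 * ε) ≤ (⌊ε₁ * d⌋₊ : ℝ) := by
    intro d hd
    have h3 := Nat.lt_floor_add_one (ε₁ * d)
    have h4 : (d₁ : ℝ) ≤ d := by exact_mod_cast hd
    have h5 : ε₁ * (β₁ * d₂ - 1) ≤ ε₁ * d := mul_le_mul_of_nonneg_left (by linarith) hε₁.1.le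
    rw [Nat.cast_add, Nat.cast_one]
    linarith
  have hd₁0 : 0 < d₁ := by
    by_contra h0
    have h3 := hfloor 0 (by omega)
    rw [Nat.cast_zero, mul_zero, Nat.floor_zero, Nat.cast_zero] at h3
    linarith
  have hk : ∀ m, 4 * m + 7 + 1 = 4 * (m + 1 + 1) := fun m => by ring
  have hl₁ : d₁ < d₂ + 1 := by omega
  have hl₂ : d₂ < d₂ + 1 := by omega
  refine ⟨d₂, ⟨(d₁, d₂), ⟨hd₁0, h12, ⟨?_, ?_⟩, (((d₂ + 1 : ℕ) : ℝ) ^ (1 - 3 * ε))⁻¹ / 2,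
    by positivity, ZMod (d₂ + 1), inferInstance, inferInstance, LU.colors (d₂ + 1) d₂,
    LU.colors (d₂ + 1) d₁, fun m => 4 * m + 7, LU.zero_notMem_colors hl₂,
    LU.zero_notMem_colors hl₁, LU.card_colors hl₁, LU.card_colors hl₂,
    fun m => ⟨Nat.le_add_left_of_le (by norm_num), ⟨2 * m + 3, by ring⟩⟩, ?_, LU.stronglyExplicit_CD hl₁ hl₂ hd₂,
    fun m => ?_⟩, rfl⟩, by omega⟩
  · rw [le_div_iff₀ hd₂']
    linarith
  · rwa [div_le_iff₀ hd₂']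
  · refine strictMono_nat_of_lt_succ fun m => ?_
    simp only [BipartiteGraph.order, LU.card_left (hk _) hl₂, LU.card_right (hk _) hl₁, ← add_mul]
    exact Nat.mul_lt_mul_of_pos_left (Nat.pow_lt_pow_right hp.one_lt (by omega)) (by omega)
  · have hbi := LU.isBiregular_CD (hk m) (LU.colors (d₂ + 1) d₂) (LU.colors (d₂ + 1) d₁)
    rw [LU.card_colors hl₁, LU.card_colors hl₂] at hbi
    refine ⟨hbi, ?_, ?_⟩
    -- For k = 4m + 7 one has r = m + 2, and m + 1 = r - 1 double steps is the largest number
    -- permitted by `uniqueWalks_left`.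
    · refine BipartiteGraph.leftExpands_of_uniqueWalks hbi.1
        (LU.uniqueWalks_left (hk m) (LU.zero_notMem_colors hl₁) (n := m + 1) le_rfl)
        (Nat.floor_le (mul_nonneg hε₁.1.le (Nat.cast_nonneg _))) ?_
      rw [LU.card_left (hk m) hl₂]
      exact LU.rpow_card_lt hd₂ hl₂.le (min_le_left _ _) (min_le_right _ _) (hfloor d₁ le_rfl)
    · refine BipartiteGraph.leftExpands_of_uniqueWalks hbi.2
        (LU.uniqueWalks_right (hk m) (LU.zero_notMem_colors hl₂) (n := m + 1) le_rfl)
        (Nat.floor_le (mul_nonneg hε₁.1.le (Nat.cast_nonneg _))) ?_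
      rw [LU.card_right (hk m) hl₁]
      exact LU.rpow_card_lt hd₁0 hl₁.le (min_le_left _ _) (min_le_right _ _) (hfloor d₂ h12)
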